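/- **Definitions.** Let $p_1,\dots,p_N$ be a finite list of points of $\mathbb{R}^d$. A nonempty affinely independent set of these points is a *corral* if the minimum-norm point of its affine hull (its affine minimizer) lies in the relative interior of its convex hull. *Wolfe's method* with the *minnorm* insertion rule, started at the minimum-norm point, maintains a set $C$ of the given points and a point $x\in\operatorname{conv} C$ with its convex coefficients $\lambda$ (so $x=\sum_{p_i\in C}\lambda_i p_i$), as follows. 1. Start with $C=\{p_i\}$, $x=p_i$, where $p_i$ has minimum norm among the given points. 2. (Major cycle.) Stop if $x=0$ or if no $p_j$ is *improving*, i.e. satisfies $x^Tp_j<\|x\|_2^2$. Otherwise add to $C$ an improving point of minimum norm. 3. (Minor cycles.) Let $y=\sum_{p_i\in C}\alpha_ip_i$ (with $\sum_i\alpha_i=1$) be the affine minimizer of $C$. If all $\alpha_i>0$, set $x=y$, $\lambda=\alpha$ and go to step 2. Otherwise let $z=\theta y+(1-\theta)x$ be the point of $[x,y]\cap\operatorname{conv}C$ closest to $y$, remove from $C$ one point $p_i$ whose coefficient $\theta\alpha_i+(1-\theta)\lambda_i$ in $z$ is $0$ (any such point may be chosen), set $x=z$ with the corresponding coefficients, and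 repeat step 3. The *corral sequence* of an execution lists the sets $C$ at the successive arrivals at step 2, including the final one; so its length is one more than the number of major cycles. The point lists $P_d\subset\mathbb{R}^d$, for odd $d\ge1$, are defined by $P_1=(1)$ and, for odd $d\ge3$, $$P_d=\bigl((v,0,0): v\in P_{d-2}\bigr)\ \text{followed by}\ p_d,q_d,r_d,s_d,$$ $$p_d=\bigl(\tfrac12x^*,\tfrac m4,M\bigr),\quad q_d=\bigl(\tfrac12x^*,\tfrac m4,-(M+1)\bigr),\quad r_d=\bigl(0,\tfrac m4,M+2\bigr),\quad s_d=\bigl(0,\tfrac m4,-(M+3)\bigr),$$ where $x^*$ is the minimum-norm point of $\operatorname{conv}P_{d-2}$, $m=\|x^*\|_\infty$ and $M=\max_{v\in P_{d-2}}\|v\|_1$. Thus $P_d$ consists of $2d-1$ points. **Theorem.** All points of all the $P_d$ are rational. For every odd $d\ge 1$ there is a sequence $C_d$ of sets of points of $P_d$ such that: * $C_d$ is the corral sequence of a terminating execution of Wolfe's method with the minnorm insertion rule on $P_d$, started at the minimum-norm point, and every terminating execution (whatever choices are made among the removable points in the minor cycles) has the corral sequence $C_d$; * the members of $C_d$ are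 corrals and are pairwise distinct; * if $d=2k-1$ with $k\ge1$, then $C_d$ has length exactly $5\cdot2^{k-1}-4$. So the method visits a number of corrals that is exponential in the dimension $d$ and in the number $2d-1$ of points; * for $d\ge3$, identifying the points of $P_{d-2}$ with their copies in $P_d$ and writing $O_{d-2}$ for the last member of $C_{d-2}$, the sequence $C_d$ is the concatenation of $C_{d-2}$, the four corrals $$O_{d-2}\cup\{p_d\},\quad \{p_d,q_d\},\quad \{q_d,r_d\},\quad \{r_d,s_d\},$$ and the sequence obtained from $C_{d-2}$ by adding $r_d$ and $s_d$ to each of its members. -/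

import Mathlib

open scoped BigOperators

namespace Wolfe

section Method

variable {ι E : Type*} [DecidableEq ι] [NormedAddCommGroup E] [InnerProductSpace ℝ E]

/-- `y` is a point of minimum norm in the set `S`. -/
def IsMinNormIn (S : Set E) (y : E) : Prop :=
  y ∈ S ∧ ∀ w ∈ S, ‖y‖ ≤ ‖w‖

/-- The combination `∑ i ∈ C, w i • p i` of the points indexed by `C`. -/
def comb (p : ι → E) (C : Finset ι) (w : ι → ℝ) : E :=
  ∑ i ∈ C, w i • p i

/-- The points indexed by `C` form a corral: they are affinely independent and the affine
minimizer (the minimum norm point of the affine hull) lies in the relative interior of the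
convex hull. -/
def IsCorral (p : ι → E) (C : Finset ι) : Prop :=
  AffineIndependent ℝ (fun i : C => p i) ∧
    ∃ y, IsMinNormIn (affineSpan ℝ (p '' (C : Set ι)) : Set E) y ∧
      y ∈ intrinsicInterior ℝ (convexHull ℝ (p '' (C : Set ι)))

/-- `α` (extended by `0` outside `C`) is a vector of affine coefficients of the affine minimizer
of the points indexed by `C`. -/
structure IsAffineCoeffs (p : ι → E) (C : Finset ι) (α : ι → ℝ) : Prop where
  eq_zero : ∀ i, i ∉ C → α i = 0
  sum_eq_one : ∑ i ∈ C, α i = 1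
  isMin : IsMinNormIn (affineSpan ℝ (p '' (C : Set ι)) : Set E) (comb p C α)

/-- The variables of Wolfe's method: the index set of the (potential) corral and the convex
coefficients `lam` of the current point `x`. -/
structure State (ι : Type*) where
  C : Finset ι
  lam : ι → ℝ

/-- The current point `x = ∑ i ∈ C, lam i • p i`. -/
def State.x (p : ι → E) (s : State ι) : E := comb p s.C s.lam

/-- One minor cycle. The affine minimizer `y` of the potential corral, with coefficients `α`, is
not a strict convex combination of it. Let `z = θ y + (1 - θ) x` be the point closest to `y` in
`[x, y] ∩ conv C`, i.e. let `θ` be the largest element of `[0, 1]` that keeps all the coefficients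
`θ α j + (1 - θ) lam j` of `z` non-negative. One index `i` at which this coefficient is zero is
removed, and `x` becomes `z`. Nothing is prescribed about which such `i` is chosen. -/
def MinorStep (p : ι → E) (s t : State ι) : Prop :=
  ∃ (α : ι → ℝ) (θ : ℝ) (i : ι),
    IsAffineCoeffs p s.C α ∧
    (∃ j ∈ s.C, α j ≤ 0) ∧
    IsGreatest {τ : ℝ | τ ∈ Set.Icc 0 1 ∧ ∀ j ∈ s.C, 0 ≤ τ * α j + (1 - τ) * s.lam j} θ ∧
    i ∈ s.C ∧ θ * α i + (1 - θ) * s.lam i = 0 ∧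
    t.C = s.C.erase i ∧
    t.lam = fun j => θ * α j + (1 - θ) * s.lam j

/-- The index `j` is improving for the current point `x`: it violates Wolfe's criterion. -/
def Improving (p : ι → E) (x : E) (j : ι) : Prop :=
  inner ℝ x (p j) < ‖x‖ ^ 2

/-- The minnorm insertion rule: among the improving points, one of minimum norm is chosen. -/
def MinnormChoice (p : ι → E) (x : E) (j : ι) : Prop :=
  Improving p x j ∧ ∀ l, Improving p x l → ‖p j‖ ≤ ‖p l‖

/-- One major cycle under the minnorm rule. While `x ≠ 0` and there is an improving point, the
chosen one is added; then minor cycles are run until the affine minimizer of the potential corral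
is a strict convex combination of it, and this affine minimizer becomes the current point. -/
def MajorStep (p : ι → E) (s t : State ι) : Prop :=
  s.x p ≠ 0 ∧
  ∃ j, MinnormChoice p (s.x p) j ∧
    ∃ u : State ι, Relation.ReflTransGen (MinorStep p) ⟨insert j s.C, s.lam⟩ u ∧
      t.C = u.C ∧ IsAffineCoeffs p u.C t.lam ∧ ∀ i ∈ u.C, 0 < t.lam i

/-- The stopping criterion of the outer loop. -/
def Terminal (p : ι → E) (s : State ι) : Prop :=
  s.x p = 0 ∨ ∀ j, ¬ Improving p (s.x p) j

/-- `RunFrom p s L`: some execution of the outer loop from the state `s` stops, and `L` lists, in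
order, the corrals at the beginnings of its major cycles, followed by the final corral. -/
inductive RunFrom (p : ι → E) : State ι → List (Finset ι) → Prop
  | halt (s : State ι) : Terminal p s → RunFrom p s [s.C]
  | step (s t : State ι) (L : List (Finset ι)) :
      MajorStep p s t → RunFrom p t L → RunFrom p s (s.C :: L)

/-- `L` is the sequence of corrals of an execution of Wolfe's method on the points `p`, started at
a point of minimum norm and using the minnorm insertion rule. -/
def IsCorralSequence (p : ι → E) (L : List (Finset ι)) : Prop :=
  ∃ i, (∀ j, ‖p i‖ ≤ ‖p j‖) ∧ RunFrom p ⟨{i}, Pi.single i 1⟩ L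

end Method

section MinNormPoint

/-- The minimum norm point of the convex hull of the points `p i`. -/
noncomputable def minNormPoint {ι E : Type*} [NormedAddCommGroup E] [InnerProductSpace ℝ E]
    (p : ι → E) : E :=
  Classical.epsilon (IsMinNormIn (convexHull ℝ (Set.range p)))

/-- For finitely many points (at least one) `minNormPoint` is indeed the minimum norm point. -/
theorem minNormPoint_spec {ι E : Type*} [Finite ι] [Nonempty ι] [NormedAddCommGroup E]
    [InnerProductSpace ℝ E] (p : ι → E) :
    IsMinNormIn (convexHull ℝ (Set.range p)) (minNormPoint p) := by
  have hc : IsCompact (convexHull ℝ (Set.range p)) :=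
    (Set.finite_range p).isCompact_convexHull ℝ
  have hne : (convexHull ℝ (Set.range p)).Nonempty :=
    (Set.range_nonempty p).convexHull
  obtain ⟨x, hx, hmin⟩ := hc.exists_isMinOn hne continuous_norm.continuousOn
  exact Classical.epsilon_spec (p := IsMinNormIn (convexHull ℝ (Set.range p)))
    ⟨x, hx, fun w hw => hmin hw⟩

end MinNormPoint

section Points

/-- The vector `(v, a, b)`. -/
noncomputable def pad {d : ℕ} (v : EuclideanSpace ℝ (Fin d)) (a b : ℝ) :
    EuclideanSpace ℝ (Fin (d + 2)) :=
  WithLp.toLp 2 (Fin.append v.ofLp ![a, b])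

/-- The largest `1`-norm of a point of a finite family. -/
noncomputable def maxOneNorm {N d : ℕ} (p : Fin (N + 1) → EuclideanSpace ℝ (Fin d)) : ℝ :=
  Finset.univ.sup' Finset.univ_nonempty fun i => ∑ c, |p i c|

/-- The sup norm of a vector. -/
noncomputable def supNorm {d : ℕ} (v : EuclideanSpace ℝ (Fin (d + 1))) : ℝ :=
  Finset.univ.sup' Finset.univ_nonempty fun c => |v c|

/-- The family in dimension `d` built from a family `Q` in dimension `d - 2 = D + 1`: the points of
`Q`, padded with two zeros, followed by the four points `p_d, q_d, r_d, s_d`. -/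
noncomputable def extend {N D : ℕ} (Q : Fin (N + 1) → EuclideanSpace ℝ (Fin (D + 1))) :
    Fin (N + 1 + 4) → EuclideanSpace ℝ (Fin (D + 1 + 2)) :=
  let x := minNormPoint Q
  let m := supNorm x
  let M := maxOneNorm Q
  Fin.append (fun i => pad (Q i) 0 0)
    ![pad ((1 / 2 : ℝ) • x) (m / 4) M,
      pad ((1 / 2 : ℝ) • x) (m / 4) (-(M + 1)),
      pad 0 (m / 4) (M + 2),
      pad 0 (m / 4) (-(M + 3))]

/-- The point set `P_d` for `d = 2 * n + 1`, as a list of `4 * n + 1` points in `ℝ ^ d`. -/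
noncomputable def P : (n : ℕ) → Fin (4 * n + 1) → EuclideanSpace ℝ (Fin (2 * n + 1))
  | 0 => fun _ => WithLp.toLp 2 fun _ => 1
  | n + 1 => extend (P n)

/-- The index in `P_d` of the copy of a point of `P_(d-2)`, for `d = 2 * (n + 1) + 1`. -/
def old (n : ℕ) : Fin (4 * n + 1) ↪ Fin (4 * (n + 1) + 1) :=
  (Fin.castAddEmb 4 : Fin (4 * n + 1) ↪ Fin (4 * n + 1 + 4))

/-- The indices in `P_d` of its last four points `p_d, q_d, r_d, s_d` (for `a = 0, 1, 2, 3`), where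
`d = 2 * (n + 1) + 1`. -/
def new (n : ℕ) (a : Fin 4) : Fin (4 * (n + 1) + 1) :=
  (Fin.natAdd (4 * n + 1) a : Fin (4 * n + 1 + 4))

end Points

end Wolfe

/-! The run on `extend Q` consists of two copies of the run on `Q`, joined by four intermediate
corrals. Let x* be the minimum norm point for `Q`, X = ‖x*‖², and let p, q, r, s be the new points,
in order of increasing norm. Since `M` bounds the norms of the old points, all old points are
shorter than the new ones (`Good.norm_lt`). So the minnorm rule inserts an old point whenever one
improves, and the run on `Q` is copied until its optimum x* is reached.

There p improves, since ⟪x*, p⟫ = X/2. In each of the next stages no old point improves and the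
shortest improving point is q, then r, then s. The old points leave when q enters, p leaves when r
enters, q leaves when s enters (`coeffs_zero`, `coeffs_zero_one`, `coeffs_one_two`,
`coeffs_two_three`). The affine minimizer of {r, s} is w = (0, m/4, 0), which is orthogonal to all
old points. Hence all of them improve again, and the run on `Q` restarts from its shortest point.

This time r and s stay. For a set C of old points, the affine minimizer of C ∪ {r, s} is τy + (1 -
τ)w with y the affine minimizer of C and 0 < τ < 1 (`exists_lift`). Thus signs of old coefficients
and improving old points are those of the smaller run, and even minor cycles correspond step by
step, for every choice of the removed point (`MinorStep.of_lifted`, `MajorStep.of_lifted`,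
`Forced.lift`). At the end p and q do not improve, so the run stops.

All affine minimizers are handled through the equations ⟪y, p i⟫ = ‖y‖² on C (`isAffineCoeffs_iff`).
Where several points are to leave in unknown order, `minorSteps_eliminate` is used. `Forced`
captures all executions at once. The explicit `minNormPoint_extend` keeps the induction hypothesis
`Good` alive and gives rationality. -/

namespace Wolfe

/-! ### Affine hulls, affine minimizers and affine independence through weights -/

section General

variable {ι E : Type*} [NormedAddCommGroup E] [InnerProductSpace ℝ E]

theorem mem_affineSpan_iff_comb (p : ι → E) (C : Finset ι) (y : E) :
    y ∈ affineSpan ℝ (p '' (C : Set ι)) ↔ ∃ w : ι → ℝ, ∑ i ∈ C, w i = 1 ∧ comb p C w = y := by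
  classical
  constructor
  · intro hy
    let S : AffineSubspace ℝ E :=
      { carrier := {z | ∃ w : ι → ℝ, ∑ i ∈ C, w i = 1 ∧ comb p C w = z}
        smul_vsub_vadd_mem' := by
          rintro c _ _ _ ⟨u, hu, rfl⟩ ⟨v, hv, rfl⟩ ⟨w, hw, rfl⟩
          refine ⟨fun i => c * (u i - v i) + w i, ?_, ?_⟩
          · rw [Finset.sum_add_distrib, ← Finset.mul_sum, Finset.sum_sub_distrib, hu, hv, hw]
            ring
          · simp only [comb, vsub_eq_sub, vadd_eq_add, add_smul, mul_smul, sub_smul,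
              Finset.sum_add_distrib, Finset.smul_sum, Finset.sum_sub_distrib, smul_sub] }
    have hS : affineSpan ℝ (p '' (C : Set ι)) ≤ S := by
      rw [affineSpan_le]
      rintro _ ⟨i, hi, rfl⟩
      refine ⟨Pi.single i 1, ?_, ?_⟩
      · rw [Finset.sum_pi_single', if_pos (by exact_mod_cast hi)]
      · rw [comb, Finset.sum_eq_single i]
        · simp
        · intro j _ hj
          simp [hj]
        · intro h
          exact absurd (by exact_mod_cast hi) h
    exact hS hy
  · rintro ⟨w, hw, rfl⟩
    have h := affineCombination_mem_affineSpan (k := ℝ) (s := (Finset.univ : Finset C))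
      (w := fun i => w i) (by rw [Finset.sum_coe_sort C w, hw]) (fun i : C => p i)
    rw [Finset.affineCombination_eq_linear_combination _ _ _
      (by rw [Finset.sum_coe_sort C w, hw])] at h
    have e : Set.range (fun i : C => p i) = p '' (C : Set ι) := by
      ext z; simp
    rw [e, Finset.sum_coe_sort C (fun i => w i • p i)] at h
    exact h

theorem inner_comb (p : ι → E) (C : Finset ι) (w : ι → ℝ) (y : E) :
    inner ℝ y (comb p C w) = ∑ i ∈ C, w i * inner ℝ y (p i) := by
  simp only [comb, inner_sum, inner_smul_right]

theorem inner_comb_of_const {p : ι → E} {C : Finset ι} {w : ι → ℝ} {y : E} {k : ℝ}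
    (h : ∀ i ∈ C, inner ℝ y (p i) = k) : inner ℝ y (comb p C w) = (∑ i ∈ C, w i) * k := by
  rw [inner_comb, Finset.sum_mul]
  exact Finset.sum_congr rfl fun i hi => by rw [h i hi]

theorem norm_le_of_inner_eq {y w : E} (h : inner ℝ y w = ‖y‖ ^ 2) : ‖y‖ ≤ ‖w‖ := by
  rcases eq_or_lt_of_le (norm_nonneg y) with h0 | h0
  · rw [← h0]; exact norm_nonneg w
  · have := real_inner_le_norm y w
    rw [h, sq] at this
    exact le_of_mul_le_mul_left this h0

theorem norm_le_of_le_inner {y w : E} (h : ‖y‖ ^ 2 ≤ inner ℝ y w) : ‖y‖ ≤ ‖w‖ := by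
  rcases eq_or_lt_of_le (norm_nonneg y) with h0 | h0
  · rw [← h0]; exact norm_nonneg w
  · have := h.trans (real_inner_le_norm y w)
    rw [sq] at this
    exact le_of_mul_le_mul_left this h0

/-- If moving from `y` towards `w` a little never decreases the norm, then
`‖y‖ ^ 2 ≤ ⟪y, w⟫`. -/
theorem le_inner_of_forall_norm_le {y w : E}
    (h : ∀ t : ℝ, 0 < t → t ≤ 1 → ‖y‖ ≤ ‖y + t • (w - y)‖) : ‖y‖ ^ 2 ≤ inner ℝ y w := by
  by_contra hlt
  push Not at hlt
  have key : ∀ t : ℝ, 0 < t → t ≤ 1 →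
      2 * (‖y‖ ^ 2 - inner ℝ y w) ≤ t * ‖w - y‖ ^ 2 := by
    intro t ht ht1
    have h1 : ‖y‖ ^ 2 ≤ ‖y + t • (w - y)‖ ^ 2 :=
      pow_le_pow_left₀ (norm_nonneg _) (h t ht ht1) 2
    rw [norm_add_sq_real, inner_smul_right, inner_sub_right, real_inner_self_eq_norm_sq,
      norm_smul, Real.norm_of_nonneg ht.le] at h1
    have h2 : 0 ≤ t * (t * ‖w - y‖ ^ 2 - 2 * (‖y‖ ^ 2 - inner ℝ y w)) := by nlinarith
    have := nonneg_of_mul_nonneg_right h2 ht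
    linarith
  set δ := ‖y‖ ^ 2 - inner ℝ y w with hδ
  have hδ0 : 0 < δ := by rw [hδ]; linarith
  have hK : 0 ≤ ‖w - y‖ ^ 2 := sq_nonneg _
  -- This t lies in (0, 1] and gives t‖w - y‖² ≤ δ, against 2δ ≤ t‖w - y‖²; the summand δ in the
  -- denominator covers w = y.
  have h1 := key (δ / (δ + ‖w - y‖ ^ 2)) (by positivity)
    (by rw [div_le_one (by positivity)]; linarith)
  have h2 : δ / (δ + ‖w - y‖ ^ 2) * ‖w - y‖ ^ 2 ≤ δ := by
    rw [div_mul_eq_mul_div, div_le_iff₀ (by positivity)]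
    nlinarith
  linarith

/-- The hull contains the whole line through y and p i, so the first order inequality holds for p i
and for its reflection 2y - p i, which gives equality. Conversely, ⟪y, ·⟫ is then constantly ‖y‖² on
the hull and Cauchy–Schwarz applies. This makes finding affine minimizers a matter of solving
equations. -/
theorem isAffineCoeffs_iff {p : ι → E} {C : Finset ι} {α : ι → ℝ} :
    IsAffineCoeffs p C α ↔ (∀ i, i ∉ C → α i = 0) ∧ ∑ i ∈ C, α i = 1 ∧
      ∀ i ∈ C, inner ℝ (comb p C α) (p i) = ‖comb p C α‖ ^ 2 := by
  constructor
  · rintro ⟨h0, h1, hy, hmin⟩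
    refine ⟨h0, h1, fun i hi => ?_⟩
    have hpi : p i ∈ affineSpan ℝ (p '' (C : Set ι)) :=
      subset_affineSpan ℝ _ ⟨i, by exact_mod_cast hi, rfl⟩
    set y := comb p C α
    have hline : ∀ t : ℝ, y + t • (p i - y) ∈ affineSpan ℝ (p '' (C : Set ι)) := by
      intro t
      have := AffineSubspace.smul_vsub_vadd_mem _ t hpi hy hy
      rwa [vsub_eq_sub, vadd_eq_add, add_comm] at this
    have ha : ‖y‖ ^ 2 ≤ inner ℝ y (p i) :=
      le_inner_of_forall_norm_le fun t _ _ => hmin _ (hline t)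
    have hb : ‖y‖ ^ 2 ≤ inner ℝ y ((2 : ℝ) • y - p i) := by
      refine le_inner_of_forall_norm_le fun t _ _ => ?_
      have h := hmin _ (hline (-t))
      have e : y + t • ((2 : ℝ) • y - p i - y) = y + -t • (p i - y) := by module
      rwa [e]
    rw [inner_sub_right, inner_smul_right, real_inner_self_eq_norm_sq] at hb
    linarith
  · rintro ⟨h0, h1, h2⟩
    refine ⟨h0, h1, (mem_affineSpan_iff_comb _ _ _).2 ⟨α, h1, rfl⟩, fun w hw => ?_⟩
    obtain ⟨β, hβ, rfl⟩ := (mem_affineSpan_iff_comb _ _ _).1 hw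
    refine norm_le_of_inner_eq ?_
    rw [inner_comb_of_const h2, hβ, one_mul]

theorem exists_isAffineCoeffs [FiniteDimensional ℝ E] (p : ι → E) {C : Finset ι}
    (hC : C.Nonempty) : ∃ α, IsAffineCoeffs p C α := by
  have hne : (affineSpan ℝ (p '' (C : Set ι)) : Set E).Nonempty := by
    obtain ⟨i, hi⟩ := hC
    exact ⟨p i, subset_affineSpan ℝ _ ⟨i, by exact_mod_cast hi, rfl⟩⟩
  have hcl : IsClosed (affineSpan ℝ (p '' (C : Set ι)) : Set E) :=
    AffineSubspace.closed_of_finiteDimensional _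
  obtain ⟨y, hy, hd⟩ := hcl.exists_infDist_eq_dist hne 0
  obtain ⟨w, hw, rfl⟩ := (mem_affineSpan_iff_comb _ _ _).1 hy
  classical
  have e : comb p C (fun i => if i ∈ C then w i else 0) = comb p C w :=
    Finset.sum_congr rfl fun i hi => by simp [hi]
  refine ⟨fun i => if i ∈ C then w i else 0, fun i hi => by simp [hi], ?_, ?_, ?_⟩
  · rw [← hw]; exact Finset.sum_congr rfl fun i hi => by simp [hi]
  · rw [e]; exact hy
  · intro z hz
    rw [e]
    have := Metric.infDist_le_dist_of_mem (x := (0 : E)) hz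
    rw [hd, dist_zero_left, dist_zero_left] at this
    exact this

/-- Affine independence of the points indexed by `C`, in terms of weights. -/
def AffIndepOn (p : ι → E) (C : Finset ι) : Prop :=
  ∀ w : ι → ℝ, ∑ i ∈ C, w i = 0 → comb p C w = 0 → ∀ i ∈ C, w i = 0

theorem AffIndepOn.mono {p : ι → E} {C D : Finset ι} (h : AffIndepOn p C) (hD : D ⊆ C) :
    AffIndepOn p D := by
  classical
  intro w hw hc i hi
  have key := h (fun i => if i ∈ D then w i else 0)
  have e1 : ∑ i ∈ C, (if i ∈ D then w i else 0) = ∑ i ∈ D, w i := by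
    rw [← Finset.sum_filter, Finset.filter_mem_eq_inter, Finset.inter_eq_right.2 hD]
  have e2 : comb p C (fun i => if i ∈ D then w i else 0) = comb p D w := by
    simp only [comb, ite_smul, zero_smul]
    rw [← Finset.sum_filter, Finset.filter_mem_eq_inter, Finset.inter_eq_right.2 hD]
  simpa [hi] using key (e1.trans hw) (e2.trans hc) i (hD hi)

theorem AffIndepOn.affineIndependent {p : ι → E} {C : Finset ι} (h : AffIndepOn p C) :
    AffineIndependent ℝ (fun i : C => p i) := by
  classical
  rw [affineIndependent_iff]
  intro s w hw hc i hi
  have key := h (fun j => if hj : j ∈ C then (if ⟨j, hj⟩ ∈ s then w ⟨j, hj⟩ else 0) else 0)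
  have e1 : ∑ j ∈ C, (if hj : j ∈ C then (if (⟨j, hj⟩ : C) ∈ s then w ⟨j, hj⟩ else 0) else 0)
      = ∑ j ∈ s, w j := by
    rw [← Finset.sum_coe_sort C, ← Finset.sum_subset (Finset.subset_univ s)]
    · exact Finset.sum_congr rfl fun j hj => by simp [hj]
    · intro j _ hj
      simp [hj]
  have e2 : comb p C (fun j => if hj : j ∈ C then
      (if (⟨j, hj⟩ : C) ∈ s then w ⟨j, hj⟩ else 0) else 0) = ∑ j ∈ s, w j • p j := by
    rw [comb, ← Finset.sum_coe_sort C, ← Finset.sum_subset (Finset.subset_univ s)]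
    · exact Finset.sum_congr rfl fun j hj => by simp [hj]
    · intro j _ hj
      simp [hj]
  have := key (e1.trans hw) (e2.trans hc) i i.2
  simpa [hi] using this

/-- The functional ⟪x, ·⟫ is constant on `C` and takes another value at p j, so an affine dependence
has weight 0 at j. -/
theorem AffIndepOn.insert [DecidableEq ι] {p : ι → E} {C : Finset ι} {x : E} {j : ι} (h : AffIndepOn p C)
    (hx : ∀ i ∈ C, inner ℝ x (p i) = ‖x‖ ^ 2) (hj : inner ℝ x (p j) < ‖x‖ ^ 2) :
    AffIndepOn p (insert j C) := by
  have hjC : j ∉ C := fun hmem => hj.ne (hx j hmem)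
  intro w hw hc
  rw [Finset.sum_insert hjC] at hw
  have hc' : w j • p j + comb p C w = 0 := by
    rw [comb, Finset.sum_insert hjC] at hc; exact hc
  have h0 : inner ℝ x (w j • p j + comb p C w) = 0 := by rw [hc', inner_zero_right]
  rw [inner_add_right, inner_smul_right, inner_comb_of_const hx] at h0
  have hwj : w j * (inner ℝ x (p j) - ‖x‖ ^ 2) = 0 := by
    have : ∑ i ∈ C, w i = - w j := by linarith
    rw [this] at h0; linarith
  have hwj0 : w j = 0 := by
    rcases mul_eq_zero.1 hwj with h' | h'
    · exact h'
    · linarith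
  rw [hwj0, zero_smul, zero_add] at hc'
  rw [hwj0, zero_add] at hw
  intro i hi
  rcases Finset.mem_insert.1 hi with rfl | hi
  · exact hwj0
  · exact h w hw hc' i hi

theorem affIndepOn_singleton (p : ι → E) (i : ι) : AffIndepOn p {i} := by
  intro w hw _ j hj
  rw [Finset.mem_singleton] at hj
  subst hj
  simpa using hw

/-- A strict convex combination of finitely many affinely independent points lies in the relative
interior of their convex hull. -/
theorem comb_mem_intrinsicInterior [FiniteDimensional ℝ E] {p : ι → E} {C : Finset ι}
    {α : ι → ℝ} (h : AffIndepOn p C) (h1 : ∑ i ∈ C, α i = 1) (hpos : ∀ i ∈ C, 0 < α i) :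
    comb p C α ∈ intrinsicInterior ℝ (convexHull ℝ (p '' (C : Set ι))) := by
  classical
  -- Affine independence says that the map from weights to (combination, total weight) is injective.
  -- A linear left inverse is continuous and reads the weights off a point of the affine hull, so
  -- positivity of the weights is an open condition there.
  let T : (C → ℝ) →ₗ[ℝ] E × ℝ :=
    LinearMap.prod (Fintype.linearCombination ℝ (fun i : C => p i))
      (Fintype.linearCombination ℝ (fun _ : C => (1 : ℝ)))
  have hT : ∀ w : ι → ℝ, T (fun i => w i) = (comb p C w, ∑ i ∈ C, w i) := by
    intro w
    refine Prod.ext ?_ ?_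
    · change Fintype.linearCombination ℝ (fun i : C => p i) (fun i : C => w i) = _
      rw [Fintype.linearCombination_apply, comb, ← Finset.sum_coe_sort C]
    · change Fintype.linearCombination ℝ (fun _ : C => (1 : ℝ)) (fun i : C => w i) = _
      rw [Fintype.linearCombination_apply, ← Finset.sum_coe_sort C]
      simp
  have hinj : LinearMap.ker T = ⊥ := by
    rw [LinearMap.ker_eq_bot']
    intro v hv
    have hv' : v = fun i : C => (fun j => if hj : j ∈ C then v ⟨j, hj⟩ else 0) (i : ι) := by
      funext i; simp
    rw [hv', hT (fun j => if hj : j ∈ C then v ⟨j, hj⟩ else 0)] at hv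
    funext i
    have := h _ (congrArg Prod.snd hv) (congrArg Prod.fst hv) i i.2
    simpa using this
  obtain ⟨G, hG⟩ := LinearMap.exists_leftInverse_of_injective T hinj
  have hGT : ∀ w : ι → ℝ, G (comb p C w, ∑ i ∈ C, w i) = fun i : C => w i := by
    intro w
    rw [← hT, ← LinearMap.comp_apply, hG, LinearMap.id_apply]
  have hGc : Continuous G := G.continuous_of_finiteDimensional
  have hopen : IsOpen {z : E | ∀ i : C, 0 < G (z, 1) i} := by
    rw [Set.ofPred_forall]
    refine isOpen_iInter_of_finite fun i => isOpen_lt continuous_const ?_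
    exact (continuous_apply i).comp (hGc.comp (by fun_prop))
  rw [mem_intrinsicInterior]
  have hspan : comb p C α ∈ affineSpan ℝ (convexHull ℝ (p '' (C : Set ι))) := by
    rw [affineSpan_convexHull]
    exact (mem_affineSpan_iff_comb _ _ _).2 ⟨α, h1, rfl⟩
  refine ⟨⟨_, hspan⟩, ?_, rfl⟩
  rw [mem_interior]
  refine ⟨(↑) ⁻¹' {z : E | ∀ i : C, 0 < G (z, 1) i}, ?_,
    hopen.preimage continuous_subtype_val, ?_⟩
  · rintro ⟨z, hz⟩ hzG
    rw [affineSpan_convexHull] at hz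
    obtain ⟨β, hβ, rfl⟩ := (mem_affineSpan_iff_comb _ _ _).1 hz
    have hb : ∀ i ∈ C, 0 < β i := by
      intro i hi
      have h2 := hzG ⟨i, hi⟩
      have h3 := hGT β
      rw [hβ] at h3
      simp only [h3] at h2
      exact h2
    change comb p C β ∈ convexHull ℝ (p '' (C : Set ι))
    exact (convex_convexHull ℝ _).sum_mem (fun i hi => (hb i hi).le) hβ
      fun i hi => subset_convexHull ℝ _ ⟨i, by exact_mod_cast hi, rfl⟩
  · intro i
    have h3 := hGT α
    rw [h1] at h3
    change 0 < G (comb p C α, 1) i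
    rw [h3]
    exact hpos i i.2

end General

/-! ### Invariants of the method, existence of steps, elimination of points -/

section Method

variable {ι E : Type*} [NormedAddCommGroup E] [InnerProductSpace ℝ E]

/-- The states in which a major cycle begins: the points are affinely independent and the current
coefficients are those of the affine minimizer, all of them positive. -/
structure Settled (p : ι → E) (s : State ι) : Prop where
  coeffs : IsAffineCoeffs p s.C s.lam
  pos : ∀ i ∈ s.C, 0 < s.lam i
  indep : AffIndepOn p s.C

/-- The states in which a minor cycle begins: the coefficients are those of a convex
combination. -/
structure IsConvexState (s : State ι) : Prop where
  nonneg : ∀ i ∈ s.C, 0 ≤ s.lam i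
  sum_eq_one : ∑ i ∈ s.C, s.lam i = 1

theorem IsConvexState.nonempty {s : State ι} (h : IsConvexState s) : s.C.Nonempty := by
  rw [Finset.nonempty_iff_ne_empty]
  intro h0
  have := h.sum_eq_one
  rw [h0, Finset.sum_empty] at this
  exact zero_ne_one this

theorem Settled.inner_eq {p : ι → E} {s : State ι} (h : Settled p s) :
    ∀ i ∈ s.C, inner ℝ (s.x p) (p i) = ‖s.x p‖ ^ 2 :=
  (isAffineCoeffs_iff.1 h.coeffs).2.2

theorem Settled.nonempty {p : ι → E} {s : State ι} (h : Settled p s) : s.C.Nonempty :=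
  IsConvexState.nonempty ⟨fun i hi => (h.pos i hi).le, h.coeffs.sum_eq_one⟩

theorem Settled.not_improving {p : ι → E} {s : State ι} (h : Settled p s) {i : ι}
    (hi : i ∈ s.C) : ¬ Improving p (s.x p) i :=
  fun hlt => hlt.ne (h.inner_eq i hi)

theorem Settled.isCorral [FiniteDimensional ℝ E] {p : ι → E} {s : State ι} (h : Settled p s) :
    IsCorral p s.C :=
  ⟨h.indep.affineIndependent, _, h.coeffs.isMin,
    comb_mem_intrinsicInterior h.indep h.coeffs.sum_eq_one h.pos⟩

theorem IsConvexState.insert [DecidableEq ι] {p : ι → E} {s : State ι} (h : Settled p s) {j : ι} (hj : j ∉ s.C) :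
    IsConvexState ⟨insert j s.C, s.lam⟩ := by
  have h0 := h.coeffs.eq_zero j hj
  refine ⟨fun i hi => ?_, ?_⟩
  · rcases Finset.mem_insert.1 hi with rfl | hi
    · exact h0.ge
    · exact (h.pos i hi).le
  · rw [Finset.sum_insert hj, h0, zero_add]
    exact h.coeffs.sum_eq_one

theorem MinorStep.isConvexState [DecidableEq ι] {p : ι → E} {s t : State ι} (h : MinorStep p s t)
    (hs : IsConvexState s) : IsConvexState t := by
  obtain ⟨α, θ, i, hα, -, hθ, hi, hz, hC, hl⟩ := h
  refine ⟨fun j hj => ?_, ?_⟩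
  · rw [hC] at hj
    rw [hl]
    exact hθ.1.2 j (Finset.mem_of_mem_erase hj)
  · rw [hC, hl, Finset.sum_erase s.C hz, Finset.sum_add_distrib, ← Finset.mul_sum,
      ← Finset.mul_sum, hα.sum_eq_one, hs.sum_eq_one]
    ring

theorem MinorStep.subset [DecidableEq ι] {p : ι → E} {s t : State ι} (h : MinorStep p s t) : t.C ⊆ s.C := by
  obtain ⟨α, θ, i, hα, -, hθ, hi, hz, hC, hl⟩ := h
  rw [hC]
  exact Finset.erase_subset _ _

theorem MinorStep.card_lt [DecidableEq ι] {p : ι → E} {s t : State ι} (h : MinorStep p s t) :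
    t.C.card < s.C.card := by
  obtain ⟨α, θ, i, hα, -, hθ, hi, hz, hC, hl⟩ := h
  rw [hC]
  exact Finset.card_erase_lt_of_mem hi

theorem subset_of_minorSteps [DecidableEq ι] {p : ι → E} {s t : State ι}
    (h : Relation.ReflTransGen (MinorStep p) s t) : t.C ⊆ s.C := by
  induction h with
  | refl => exact Finset.Subset.refl _
  | tail _ h ih => exact h.subset.trans ih

/-- The coefficients that are positive, or non-negative with a positive target, do not vanish
immediately on the way to the affine minimizer. -/
theorem theta_pos {C : Finset ι} {α lam : ι → ℝ} {θ : ℝ}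
    (hθ : IsGreatest {τ : ℝ | τ ∈ Set.Icc 0 1 ∧ ∀ j ∈ C, 0 ≤ τ * α j + (1 - τ) * lam j} θ)
    (h : ∀ j ∈ C, 0 < lam j ∨ (0 ≤ lam j ∧ 0 < α j)) : 0 < θ := by
  have h1 : ∀ᶠ τ : ℝ in nhdsWithin 0 (Set.Ioi 0), τ < 1 :=
    nhdsWithin_le_nhds (Iio_mem_nhds zero_lt_one)
  have h2 : ∀ᶠ τ : ℝ in nhdsWithin 0 (Set.Ioi 0), 0 < τ := self_mem_nhdsWithin
  have h3 : ∀ᶠ τ : ℝ in nhdsWithin 0 (Set.Ioi 0),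
      ∀ j ∈ C, 0 ≤ τ * α j + (1 - τ) * lam j := by
    rw [Filter.eventually_all_finset]
    intro j hj
    rcases h j hj with hl | ⟨hl, ha⟩
    · have hc : Continuous fun τ : ℝ => τ * α j + (1 - τ) * lam j := by fun_prop
      have : ∀ᶠ τ : ℝ in nhds 0, 0 < τ * α j + (1 - τ) * lam j :=
        hc.continuousAt.eventually (lt_mem_nhds (by simpa using hl))
      filter_upwards [nhdsWithin_le_nhds this] with τ hτ using hτ.le
    · filter_upwards [h1, h2] with τ ht1 ht0
      have : 0 ≤ 1 - τ := by linarith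
      positivity
  obtain ⟨τ, h1, h2, h3⟩ := (h1.and (h2.and h3)).exists
  exact h2.trans_le (hθ.2 ⟨⟨h2.le, h1.le⟩, h3⟩)

/-- The admissible parameters form a compact set containing 0, so a largest one exists. If no
coefficient vanished there, it would be below 1 because of `hneg`, and could be increased slightly.
-/
theorem exists_minorStep [DecidableEq ι] {p : ι → E} {s : State ι} (hs : IsConvexState s) {α : ι → ℝ}
    (hα : IsAffineCoeffs p s.C α) (hneg : ∃ j ∈ s.C, α j ≤ 0) : ∃ t, MinorStep p s t := by
  set S := {τ : ℝ | τ ∈ Set.Icc (0 : ℝ) 1 ∧ ∀ j ∈ s.C, 0 ≤ τ * α j + (1 - τ) * s.lam j} with hS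
  have hcl : IsClosed S := by
    have : S = Set.Icc 0 1 ∩ ⋂ j ∈ s.C, {τ : ℝ | 0 ≤ τ * α j + (1 - τ) * s.lam j} := by
      ext τ; simp [hS]
    rw [this]
    refine isClosed_Icc.inter (isClosed_biInter fun j _ => isClosed_le continuous_const ?_)
    fun_prop
  have hcomp : IsCompact S :=
    isCompact_Icc.of_isClosed_subset hcl fun τ hτ => hτ.1
  have h0 : (0 : ℝ) ∈ S := ⟨⟨le_rfl, zero_le_one⟩, fun j hj => by simpa using hs.nonneg j hj⟩
  obtain ⟨θ, hθ⟩ := hcomp.exists_isGreatest ⟨0, h0⟩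
  have hzero : ∃ i ∈ s.C, θ * α i + (1 - θ) * s.lam i = 0 := by
    by_contra hno
    push Not at hno
    have hpos : ∀ j ∈ s.C, 0 < θ * α j + (1 - θ) * s.lam j := fun j hj =>
      lt_of_le_of_ne (hθ.1.2 j hj) (hno j hj).symm
    have hθ1 : θ < 1 := by
      refine lt_of_le_of_ne hθ.1.1.2 ?_
      rintro rfl
      obtain ⟨j, hj, hj0⟩ := hneg
      have := hpos j hj
      simp at this
      linarith
    have e1 : ∀ᶠ τ : ℝ in nhdsWithin θ (Set.Ioi θ), τ < 1 :=
      nhdsWithin_le_nhds (Iio_mem_nhds hθ1)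
    have e2 : ∀ᶠ τ : ℝ in nhdsWithin θ (Set.Ioi θ), θ < τ := self_mem_nhdsWithin
    have e3 : ∀ᶠ τ : ℝ in nhdsWithin θ (Set.Ioi θ),
        ∀ j ∈ s.C, 0 ≤ τ * α j + (1 - τ) * s.lam j := by
      rw [Filter.eventually_all_finset]
      intro j hj
      have hc : Continuous fun τ : ℝ => τ * α j + (1 - τ) * s.lam j := by fun_prop
      have : ∀ᶠ τ : ℝ in nhds θ, 0 < τ * α j + (1 - τ) * s.lam j :=
        hc.continuousAt.eventually (lt_mem_nhds (hpos j hj))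
      filter_upwards [nhdsWithin_le_nhds this] with τ hτ using hτ.le
    obtain ⟨τ, h1, h2, h3⟩ := (e1.and (e2.and e3)).exists
    exact absurd (hθ.2 (show τ ∈ S from ⟨⟨hθ.1.1.1.trans h2.le, h1.le⟩, h3⟩)) (not_le.2 h2)
  obtain ⟨i, hi, hz⟩ := hzero
  exact ⟨⟨s.C.erase i, fun j => θ * α j + (1 - θ) * s.lam j⟩, α, θ, i, hα, hneg, hθ, hi, hz,
    rfl, rfl⟩

/-- The minor cycles can be run to their end. -/
theorem exists_minorSteps [DecidableEq ι] [FiniteDimensional ℝ E] (p : ι → E) (s : State ι)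
    (hs : IsConvexState s) : ∃ u α, Relation.ReflTransGen (MinorStep p) s u ∧
      IsAffineCoeffs p u.C α ∧ ∀ i ∈ u.C, 0 < α i := by
  induction hn : s.C.card using Nat.strong_induction_on generalizing s with
  | _ n ih =>
    obtain ⟨α, hα⟩ := exists_isAffineCoeffs p hs.nonempty
    by_cases hneg : ∃ j ∈ s.C, α j ≤ 0
    · obtain ⟨t, ht⟩ := exists_minorStep hs hα hneg
      obtain ⟨u, β, hu, hβ⟩ := ih t.C.card (hn ▸ ht.card_lt) t (ht.isConvexState hs) rfl
      exact ⟨u, β, Relation.ReflTransGen.head ht hu, hβ⟩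
    · push Not at hneg
      exact ⟨s, α, Relation.ReflTransGen.refl, hα, hneg⟩

theorem exists_majorStep [DecidableEq ι] [FiniteDimensional ℝ E] [Finite ι] {p : ι → E} {s : State ι}
    (hs : Settled p s) (hT : ¬ Terminal p s) : ∃ t, MajorStep p s t := by
  unfold Terminal at hT
  push Not at hT
  obtain ⟨hx, j, hj⟩ := hT
  obtain ⟨l, hl, hmin⟩ := Set.exists_min_image {l | Improving p (s.x p) l} (fun l => ‖p l‖)
    (Set.toFinite _) ⟨j, hj⟩
  obtain ⟨u, α, hu, hα, hpos⟩ := exists_minorSteps p _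
    (IsConvexState.insert hs (j := l) fun h => hs.not_improving h hl)
  exact ⟨⟨u.C, α⟩, hx, l, ⟨hl, hmin⟩, u, hu, rfl, hα, hpos⟩

theorem MajorStep.settled [DecidableEq ι] {p : ι → E} {s t : State ι} (h : MajorStep p s t) (hs : Settled p s) :
    Settled p t := by
  obtain ⟨-, j, hj, u, hu, hC, hα, hpos⟩ := h
  refine ⟨hC ▸ hα, hC ▸ hpos, ?_⟩
  rw [hC]
  exact (hs.indep.insert hs.inner_eq hj.1).mono (subset_of_minorSteps hu)

/-- Every execution from `s` stops, and all of them have the corral sequence `L`. -/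
inductive Forced [DecidableEq ι] (p : ι → E) : State ι → List (Finset ι) → Prop
  | halt (s : State ι) : Terminal p s → Forced p s [s.C]
  | step (s : State ι) (L : List (Finset ι)) :
      ¬ Terminal p s → (∀ t, MajorStep p s t → Forced p t L) → Forced p s (s.C :: L)

theorem MajorStep.not_terminal [DecidableEq ι] {p : ι → E} {s t : State ι} (h : MajorStep p s t) :
    ¬ Terminal p s := by
  obtain ⟨hx, j, hj, -⟩ := h
  rintro (h0 | h0)
  · exact hx h0
  · exact h0 j hj.1

/-- `Forced` by itself could hold vacuously; that an execution with this sequence exists comes from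
`exists_majorStep`, which needs the state to be `Settled`. -/
theorem Forced.runFrom_iff [DecidableEq ι] [FiniteDimensional ℝ E] [Finite ι] {p : ι → E} {s : State ι}
    {L : List (Finset ι)} (h : Forced p s L) (hs : Settled p s) (K : List (Finset ι)) :
    RunFrom p s K ↔ K = L := by
  induction h generalizing K with
  | halt s hT =>
    constructor
    · rintro (_ | ⟨_, t, K, hM, -⟩)
      · rfl
      · exact absurd hT hM.not_terminal
    · rintro rfl
      exact RunFrom.halt s hT
  | step s L hT hM ih =>
    constructor
    · rintro (⟨_, hT'⟩ | ⟨_, t, K, hM', hR⟩)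
      · exact absurd hT' hT
      · rw [(ih t hM' (hM'.settled hs) K).1 hR]
    · rintro rfl
      obtain ⟨t, ht⟩ := exists_majorStep hs hT
      exact RunFrom.step s t L ht ((ih t ht (ht.settled hs) L).2 rfl)

theorem Forced.isCorral [DecidableEq ι] [FiniteDimensional ℝ E] [Finite ι] {p : ι → E} {s : State ι}
    {L : List (Finset ι)} (h : Forced p s L) (hs : Settled p s) : ∀ S ∈ L, IsCorral p S := by
  induction h with
  | halt s hT =>
    intro S hS
    rw [List.mem_singleton] at hS
    exact hS ▸ hs.isCorral
  | step s L hT hM ih =>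
    intro S hS
    rcases List.mem_cons.1 hS with rfl | hS
    · exact hs.isCorral
    · obtain ⟨t, ht⟩ := exists_majorStep hs hT
      exact ih t ht (ht.settled hs) S hS

theorem settled_singleton [DecidableEq ι] (p : ι → E) (i : ι) : Settled p ⟨{i}, Pi.single i 1⟩ := by
  have hc : comb p {i} (Pi.single i (1 : ℝ)) = p i := by simp [comb]
  refine ⟨isAffineCoeffs_iff.2 ⟨fun j hj => ?_, by simp, fun j hj => ?_⟩, fun j hj => ?_,
    affIndepOn_singleton p i⟩
  · rw [Finset.mem_singleton] at hj
    simp [hj]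
  · rw [Finset.mem_singleton] at hj
    subst hj
    rw [hc, real_inner_self_eq_norm_sq]
  · rw [Finset.mem_singleton] at hj
    subst hj
    simp

/-- Minor cycles that eliminate precisely the points of `A`: as long as some of these are left, the
coefficients of the affine minimizer are positive on `B`, but not all of them are positive. -/
theorem minorSteps_eliminate [DecidableEq ι] {p : ι → E} {A B : Finset ι}
    (h : ∀ A' ⊆ A, ∀ α, IsAffineCoeffs p (A' ∪ B) α →
      (∀ i ∈ B, 0 < α i) ∧ (A'.Nonempty → ∃ i ∈ A', α i ≤ 0))
    {s u : State ι} (hs : s.C = A ∪ B) (hA : ∀ i ∈ A, 0 < s.lam i) (hB : ∀ i ∈ B, 0 ≤ s.lam i)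
    (hu : Relation.ReflTransGen (MinorStep p) s u) {α : ι → ℝ} (hα : IsAffineCoeffs p u.C α)
    (hpos : ∀ i ∈ u.C, 0 < α i) : u.C = B := by
  -- The freshly inserted point has coefficient 0 and may lie in `B`. While the coefficients on `A'`
  -- are still positive, the first step has θ > 0 and makes all of `B` positive. Afterwards ties may
  -- produce θ = 0 and zeros on `A'`, but `B` stays positive, so only points of `A'` are ever
  -- removed.
  have inv : ∃ A' ⊆ A, u.C = A' ∪ B ∧
      ((∀ i ∈ B, 0 < u.lam i) ∨ ((∀ i ∈ B, 0 ≤ u.lam i) ∧ ∀ i ∈ A', 0 < u.lam i)) := by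
    clear hα hpos
    induction hu with
    | refl => exact ⟨A, Finset.Subset.refl _, hs, Or.inr ⟨hB, hA⟩⟩
    | @tail v w _ hvw ih =>
      obtain ⟨A', hA', hC, hlam⟩ := ih
      obtain ⟨β, θ, i, hβ, hneg, hθ, hi, hz, hwC, hwl⟩ := hvw
      rw [hC] at hβ hneg hi
      obtain ⟨hβB, -⟩ := h A' hA' β hβ
      have hpB : ∀ i ∈ B, 0 < θ * β i + (1 - θ) * v.lam i := by
        intro k hk
        have h1 : 0 ≤ 1 - θ := by linarith [hθ.1.1.2]
        rcases hlam with hl | ⟨hl, hl'⟩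
        · rcases eq_or_lt_of_le hθ.1.1.1 with h0 | h0
          · rw [← h0]; simpa using hl k hk
          · have := mul_pos h0 (hβB k hk)
            have := mul_nonneg h1 (hl k hk).le
            linarith
        · have h0 : 0 < θ := by
            refine theta_pos hθ fun j hj => ?_
            rw [hC] at hj
            rcases Finset.mem_union.1 hj with hj | hj
            · exact Or.inl (hl' j hj)
            · exact Or.inr ⟨hl j hj, hβB j hj⟩
          have := mul_pos h0 (hβB k hk)
          have := mul_nonneg h1 (hl k hk)
          linarith
      have hiB : i ∉ B := fun hiB => (hpB i hiB).ne' hz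
      refine ⟨A'.erase i, (Finset.erase_subset _ _).trans hA', ?_, Or.inl fun k hk => ?_⟩
      · rw [hwC, hC, Finset.erase_union_distrib, Finset.erase_eq_of_notMem hiB]
      · rw [hwl]; exact hpB k hk
  obtain ⟨A', hA', hC, -⟩ := inv
  rcases A'.eq_empty_or_nonempty with h0 | h0
  · rw [hC, h0, Finset.empty_union]
  · rw [hC] at hα hpos
    obtain ⟨i, hi, hi0⟩ := (h A' hA' α hα).2 h0
    exact absurd (hpos i (Finset.mem_union_left _ hi)) (not_lt.2 hi0)

/-- A major cycle that inserts a point `l` and eliminates precisely the points of `A`. -/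
theorem MajorStep.exists_eq_of_eliminate [DecidableEq ι] {p : ι → E} {s t : State ι}
    (hst : MajorStep p s t) (hs : Settled p s) {A : Finset ι} {B : ι → Finset ι} (hA : A ⊆ s.C)
    (h : ∀ l, MinnormChoice p (s.x p) l → insert l s.C = A ∪ B l ∧
      ∀ A' ⊆ A, ∀ α, IsAffineCoeffs p (A' ∪ B l) α →
        (∀ i ∈ B l, 0 < α i) ∧ (A'.Nonempty → ∃ i ∈ A', α i ≤ 0)) :
    ∃ l, MinnormChoice p (s.x p) l ∧ t.C = B l := by
  obtain ⟨-, l, hl, u, hu, htC, hα, hpos⟩ := hst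
  obtain ⟨hC, hcoef⟩ := h l hl
  refine ⟨l, hl, ?_⟩
  rw [htC]
  have hconv := IsConvexState.insert hs (j := l) fun h => hs.not_improving h hl.1
  refine minorSteps_eliminate (s := ⟨insert l s.C, s.lam⟩) hcoef hC
    (fun i hi => hs.pos i (hA hi)) (fun i hi => ?_) hu hα hpos
  refine hconv.nonneg i ?_
  rw [hC]
  exact Finset.mem_union_right _ hi

theorem MajorStep.eq_of_eliminate [DecidableEq ι] {p : ι → E} {s t : State ι}
    (hst : MajorStep p s t) (hs : Settled p s) {A B : Finset ι} {j : ι} (hA : A ⊆ s.C)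
    (hj : ∀ l, MinnormChoice p (s.x p) l → l = j) (hC : insert j s.C = A ∪ B)
    (h : ∀ A' ⊆ A, ∀ α, IsAffineCoeffs p (A' ∪ B) α →
      (∀ i ∈ B, 0 < α i) ∧ (A'.Nonempty → ∃ i ∈ A', α i ≤ 0)) :
    t.C = B := by
  obtain ⟨l, -, hl⟩ := hst.exists_eq_of_eliminate hs (B := fun _ => B) hA
    fun l hl => ⟨by rw [hj l hl, hC], h⟩
  exact hl

end Method

/-! ### Coordinates of padded vectors -/

section Pad

variable {d : ℕ}

@[simp] theorem pad_castAdd (v : EuclideanSpace ℝ (Fin d)) (a b : ℝ) (c : Fin d) :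
    pad v a b (Fin.castAdd 2 c) = v c := by
  simp [pad]

@[simp] theorem pad_natAdd_zero (v : EuclideanSpace ℝ (Fin d)) (a b : ℝ) :
    pad v a b (Fin.natAdd d 0) = a := by
  simp [pad]

@[simp] theorem pad_natAdd_one (v : EuclideanSpace ℝ (Fin d)) (a b : ℝ) :
    pad v a b (Fin.natAdd d 1) = b := by
  simp [pad]

theorem ext_pad {y z : EuclideanSpace ℝ (Fin (d + 2))}
    (h : ∀ c, y (Fin.castAdd 2 c) = z (Fin.castAdd 2 c))
    (h0 : y (Fin.natAdd d 0) = z (Fin.natAdd d 0)) (h1 : y (Fin.natAdd d 1) = z (Fin.natAdd d 1)) :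
    y = z := by
  ext c
  refine Fin.addCases h (fun c => ?_) c
  fin_cases c
  · exact h0
  · exact h1

theorem smul_pad (t : ℝ) (v : EuclideanSpace ℝ (Fin d)) (a b : ℝ) :
    t • pad v a b = pad (t • v) (t * a) (t * b) := by
  refine ext_pad (fun c => ?_) ?_ ?_ <;> simp [PiLp.smul_apply]

theorem pad_add_pad (v w : EuclideanSpace ℝ (Fin d)) (a b a' b' : ℝ) :
    pad v a b + pad w a' b' = pad (v + w) (a + a') (b + b') := by
  refine ext_pad (fun c => ?_) ?_ ?_ <;> simp [PiLp.add_apply]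

theorem sum_pad {ι : Type*} (s : Finset ι) (v : ι → EuclideanSpace ℝ (Fin d)) (a b : ι → ℝ) :
    ∑ i ∈ s, pad (v i) (a i) (b i) = pad (∑ i ∈ s, v i) (∑ i ∈ s, a i) (∑ i ∈ s, b i) := by
  classical
  induction s using Finset.induction_on with
  | empty => refine ext_pad (fun c => ?_) ?_ ?_ <;> simp
  | insert i s hi ih =>
    rw [Finset.sum_insert hi, Finset.sum_insert hi, Finset.sum_insert hi, Finset.sum_insert hi, ih,
      pad_add_pad]

theorem inner_pad (v w : EuclideanSpace ℝ (Fin d)) (a b a' b' : ℝ) :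
    inner ℝ (pad v a b) (pad w a' b') = inner ℝ v w + a * a' + b * b' := by
  rw [PiLp.inner_apply, PiLp.inner_apply, Fin.sum_univ_add, Fin.sum_univ_two]
  simp only [pad_castAdd, pad_natAdd_zero, pad_natAdd_one, RCLike.inner_apply, conj_trivial]
  ring

theorem norm_sq_pad (v : EuclideanSpace ℝ (Fin d)) (a b : ℝ) :
    ‖pad v a b‖ ^ 2 = ‖v‖ ^ 2 + a ^ 2 + b ^ 2 := by
  rw [← real_inner_self_eq_norm_sq, inner_pad, real_inner_self_eq_norm_sq]
  ring

end Pad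

/-! ### Variational characterization of the minimum norm point -/

section MinNorm

variable {ι E : Type*} [NormedAddCommGroup E] [InnerProductSpace ℝ E]

theorem minNormPoint_inner [Finite ι] [Nonempty ι] (p : ι → E) (i : ι) :
    ‖minNormPoint p‖ ^ 2 ≤ inner ℝ (minNormPoint p) (p i) := by
  obtain ⟨hmem, hmin⟩ := minNormPoint_spec p
  refine le_inner_of_forall_norm_le fun t ht ht1 => hmin _ ?_
  have := (convex_convexHull ℝ (Set.range p)).add_smul_sub_mem hmem
    (subset_convexHull ℝ _ (Set.mem_range_self i)) ⟨ht.le, ht1⟩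
  exact this

theorem le_inner_of_mem_convexHull {p : ι → E} {y w : E} {k : ℝ}
    (h : ∀ i, k ≤ inner ℝ y (p i)) (hw : w ∈ convexHull ℝ (Set.range p)) : k ≤ inner ℝ y w := by
  have hc : Convex ℝ {z : E | k ≤ inner ℝ y z} :=
    convex_halfSpace_ge (innerSL ℝ y).isLinear k
  refine convexHull_min ?_ hc hw
  rintro _ ⟨i, rfl⟩
  exact h i

/-- Both points satisfy the variational inequality, each tested against the other; the sum of the
two says that the squared distance is at most 0. -/
theorem eq_minNormPoint [Finite ι] [Nonempty ι] {p : ι → E} {y : E}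
    (hy : y ∈ convexHull ℝ (Set.range p)) (h : ∀ i, ‖y‖ ^ 2 ≤ inner ℝ y (p i)) :
    y = minNormPoint p := by
  obtain ⟨hmem, -⟩ := minNormPoint_spec p
  have h1 := le_inner_of_mem_convexHull h hmem
  have h2 := le_inner_of_mem_convexHull (minNormPoint_inner p) hy
  rw [← sub_eq_zero, ← norm_eq_zero, ← sq_eq_zero_iff]
  refine le_antisymm ?_ (sq_nonneg _)
  rw [norm_sub_sq_real]
  rw [real_inner_comm] at h2
  linarith

theorem comb_mem_convexHull {p : ι → E} {C : Finset ι} {w : ι → ℝ} (h0 : ∀ i ∈ C, 0 ≤ w i)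
    (h1 : ∑ i ∈ C, w i = 1) : comb p C w ∈ convexHull ℝ (Set.range p) :=
  (convex_convexHull ℝ _).sum_mem h0 h1 fun i _ => subset_convexHull ℝ _ ⟨i, rfl⟩

end MinNorm

/-! ### The extended family: combinations, optimality equations, norms -/

section Extend

variable {N D : ℕ}

/-- The index of the copy of a point of the smaller family. -/
def oldEmb (N : ℕ) : Fin (N + 1) ↪ Fin (N + 1 + 4) := Fin.castAddEmb 4

/-- The indices of the four additional points. -/
def newIdx (N : ℕ) (a : Fin 4) : Fin (N + 1 + 4) := Fin.natAdd (N + 1) a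

theorem newIdx_injective (N : ℕ) : Function.Injective (newIdx N) := Fin.natAdd_injective _ _

theorem oldEmb_ne_newIdx (i : Fin (N + 1)) (a : Fin 4) : oldEmb N i ≠ newIdx N a := by
  intro h
  have := congrArg Fin.val h
  simp [oldEmb, newIdx] at this
  omega

theorem newIdx_notMem_map (C : Finset (Fin (N + 1))) (a : Fin 4) :
    newIdx N a ∉ C.map (oldEmb N) := by
  intro h
  obtain ⟨i, -, hi⟩ := Finset.mem_map.1 h
  exact oldEmb_ne_newIdx i a hi

theorem idx_cases (j : Fin (N + 1 + 4)) :
    (∃ i, j = oldEmb N i) ∨ j = newIdx N 0 ∨ j = newIdx N 1 ∨ j = newIdx N 2 ∨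
      j = newIdx N 3 := by
  refine Fin.addCases (fun i => Or.inl ⟨i, rfl⟩) (fun a => Or.inr ?_) j
  fin_cases a <;> simp [newIdx]

variable (Q : Fin (N + 1) → EuclideanSpace ℝ (Fin (D + 1)))

theorem extend_old (i : Fin (N + 1)) : extend Q (oldEmb N i) = pad (Q i) 0 0 := by
  simp [extend, oldEmb]

theorem extend_new_zero : extend Q (newIdx N 0) =
    pad ((1 / 2 : ℝ) • minNormPoint Q) (supNorm (minNormPoint Q) / 4) (maxOneNorm Q) := by
  simp [extend, newIdx]

theorem extend_new_one : extend Q (newIdx N 1) =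
    pad ((1 / 2 : ℝ) • minNormPoint Q) (supNorm (minNormPoint Q) / 4) (-(maxOneNorm Q + 1)) := by
  simp [extend, newIdx]

theorem extend_new_two : extend Q (newIdx N 2) =
    pad 0 (supNorm (minNormPoint Q) / 4) (maxOneNorm Q + 2) := by
  simp [extend, newIdx]

theorem extend_new_three : extend Q (newIdx N 3) =
    pad 0 (supNorm (minNormPoint Q) / 4) (-(maxOneNorm Q + 3)) := by
  simp [extend, newIdx]

theorem sum_extend {C : Finset (Fin (N + 1 + 4))} {α : Fin (N + 1 + 4) → ℝ}
    (h0 : ∀ j, j ∉ C → α j = 0) : ∑ j ∈ C, α j = ∑ i, α (oldEmb N i) + (α (newIdx N 0) +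
      α (newIdx N 1) + α (newIdx N 2) + α (newIdx N 3)) := by
  rw [Finset.sum_subset (Finset.subset_univ C) fun j _ hj => h0 j hj, Fin.sum_univ_add,
    Fin.sum_univ_four]
  rfl

/-- Coefficients vanish off `C`, so the sum may run over all indices; this one formula then serves
every set of points that occurs. -/
theorem comb_extend {C : Finset (Fin (N + 1 + 4))} {α : Fin (N + 1 + 4) → ℝ}
    (h0 : ∀ j, j ∉ C → α j = 0) :
    comb (extend Q) C α =
      pad (∑ i, α (oldEmb N i) • Q i +
          ((α (newIdx N 0) + α (newIdx N 1)) / 2) • minNormPoint Q)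
        ((α (newIdx N 0) + α (newIdx N 1) + α (newIdx N 2) + α (newIdx N 3)) *
          (supNorm (minNormPoint Q) / 4))
        (α (newIdx N 0) * maxOneNorm Q - α (newIdx N 1) * (maxOneNorm Q + 1) +
          α (newIdx N 2) * (maxOneNorm Q + 2) - α (newIdx N 3) * (maxOneNorm Q + 3)) := by
  have e : comb (extend Q) C α = ∑ i, α (oldEmb N i) • extend Q (oldEmb N i) +
      (α (newIdx N 0) • extend Q (newIdx N 0) + α (newIdx N 1) • extend Q (newIdx N 1) +
      α (newIdx N 2) • extend Q (newIdx N 2) + α (newIdx N 3) • extend Q (newIdx N 3)) := by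
    rw [comb, Finset.sum_subset (Finset.subset_univ C) fun j _ hj => by rw [h0 j hj, zero_smul],
      Fin.sum_univ_add, Fin.sum_univ_four]
    rfl
  rw [e]
  simp only [extend_old, extend_new_zero, extend_new_one, extend_new_two, extend_new_three,
    smul_pad, sum_pad, pad_add_pad, mul_zero, Finset.sum_const_zero, smul_zero]
  congr 1
  · module
  · ring
  · ring

theorem comb_eq_sum {ι E : Type*} [Fintype ι] [NormedAddCommGroup E] [InnerProductSpace ℝ E]
    {p : ι → E} {C : Finset ι} {α : ι → ℝ} (h0 : ∀ j, j ∉ C → α j = 0) :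
    comb p C α = ∑ j, α j • p j :=
  Finset.sum_subset (Finset.subset_univ C) fun j _ hj => by rw [h0 j hj, zero_smul]

/-- What the construction requires of the smaller family. -/
structure Good (Q : Fin (N + 1) → EuclideanSpace ℝ (Fin (D + 1))) : Prop where
  ne_zero : minNormPoint Q ≠ 0
  norm_le_one : ‖minNormPoint Q‖ ≤ 1

theorem norm_le_sum_abs {d : ℕ} (v : EuclideanSpace ℝ (Fin d)) : ‖v‖ ≤ ∑ c, |v c| := by
  rw [EuclideanSpace.norm_eq]
  refine Real.sqrt_le_iff.2 ⟨Finset.sum_nonneg fun _ _ => abs_nonneg _, ?_⟩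
  simp only [Real.norm_eq_abs]
  exact Finset.sum_sq_le_sq_sum_of_nonneg fun _ _ => abs_nonneg _

theorem norm_le_maxOneNorm (i : Fin (N + 1)) : ‖Q i‖ ≤ maxOneNorm Q :=
  (norm_le_sum_abs _).trans
    (Finset.le_sup' (fun i => ∑ c, |Q i c|) (Finset.mem_univ i))

theorem supNorm_pos {v : EuclideanSpace ℝ (Fin (D + 1))} (hv : v ≠ 0) : 0 < supNorm v := by
  by_contra h
  refine hv (PiLp.ext fun c => ?_)
  have h1 : |v c| ≤ supNorm v := Finset.le_sup' (fun c => |v c|) (Finset.mem_univ c)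
  exact abs_nonpos_iff.1 (h1.trans (not_lt.1 h))

theorem exists_supNorm_eq (v : EuclideanSpace ℝ (Fin (D + 1))) : ∃ c, supNorm v = |v c| := by
  obtain ⟨c, -, hc⟩ := Finset.exists_mem_eq_sup' Finset.univ_nonempty fun c => |v c|
  exact ⟨c, hc⟩

theorem supNorm_sq_le (v : EuclideanSpace ℝ (Fin (D + 1))) : supNorm v ^ 2 ≤ ‖v‖ ^ 2 := by
  obtain ⟨c, hc⟩ := exists_supNorm_eq v
  rw [hc]
  exact pow_le_pow_left₀ (abs_nonneg _) (PiLp.norm_apply_le v c) 2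

variable {Q}

/-- The inequalities on which the construction rests. -/
theorem Good.bounds (hQ : Good Q) :
    0 < ‖minNormPoint Q‖ ^ 2 ∧ ‖minNormPoint Q‖ ^ 2 ≤ 1 ∧ 0 < supNorm (minNormPoint Q) ∧
      supNorm (minNormPoint Q) ^ 2 ≤ ‖minNormPoint Q‖ ^ 2 ∧ 0 < maxOneNorm Q ∧
      ‖minNormPoint Q‖ ^ 2 ≤ maxOneNorm Q ^ 2 := by
  have h1 : ‖minNormPoint Q‖ ≤ maxOneNorm Q :=
    (norm_le_of_le_inner (minNormPoint_inner Q 0)).trans (norm_le_maxOneNorm Q 0)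
  have h2 : 0 < ‖minNormPoint Q‖ := norm_pos_iff.2 hQ.ne_zero
  exact ⟨by positivity, pow_le_one₀ h2.le hQ.norm_le_one, supNorm_pos hQ.ne_zero,
    supNorm_sq_le _, h2.trans_le h1, pow_le_pow_left₀ h2.le h1 2⟩

/-- The conditions on affine coefficients for a set of points of the extended family. -/
theorem extend_coeffs {C : Finset (Fin (N + 1 + 4))} {α : Fin (N + 1 + 4) → ℝ}
    (hα : IsAffineCoeffs (extend Q) C α) {a : EuclideanSpace ℝ (Fin (D + 1))} {b c : ℝ}
    (hc : comb (extend Q) C α = pad a b c) :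
    (∀ i, oldEmb N i ∈ C → inner ℝ a (Q i) = ‖a‖ ^ 2 + b ^ 2 + c ^ 2) ∧
    (newIdx N 0 ∈ C → inner ℝ a (minNormPoint Q) / 2 + b * (supNorm (minNormPoint Q) / 4) +
      c * maxOneNorm Q = ‖a‖ ^ 2 + b ^ 2 + c ^ 2) ∧
    (newIdx N 1 ∈ C → inner ℝ a (minNormPoint Q) / 2 + b * (supNorm (minNormPoint Q) / 4) -
      c * (maxOneNorm Q + 1) = ‖a‖ ^ 2 + b ^ 2 + c ^ 2) ∧
    (newIdx N 2 ∈ C → b * (supNorm (minNormPoint Q) / 4) +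
      c * (maxOneNorm Q + 2) = ‖a‖ ^ 2 + b ^ 2 + c ^ 2) ∧
    (newIdx N 3 ∈ C → b * (supNorm (minNormPoint Q) / 4) -
      c * (maxOneNorm Q + 3) = ‖a‖ ^ 2 + b ^ 2 + c ^ 2) := by
  have h := (isAffineCoeffs_iff.1 hα).2.2
  rw [hc, norm_sq_pad] at h
  refine ⟨fun i hi => ?_, fun hi => ?_, fun hi => ?_, fun hi => ?_, fun hi => ?_⟩
  · rw [← h _ hi, extend_old, inner_pad]; ring
  · rw [← h _ hi, extend_new_zero, inner_pad, inner_smul_right]; ring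
  · rw [← h _ hi, extend_new_one, inner_pad, inner_smul_right]; ring
  · rw [← h _ hi, extend_new_two, inner_pad, inner_zero_right]; ring
  · rw [← h _ hi, extend_new_three, inner_pad, inner_zero_right]; ring

theorem improving_old {y : EuclideanSpace ℝ (Fin (D + 1 + 2))}
    {a : EuclideanSpace ℝ (Fin (D + 1))} {b c : ℝ} (hy : y = pad a b c) (i : Fin (N + 1)) :
    Improving (extend Q) y (oldEmb N i) ↔ inner ℝ a (Q i) < ‖y‖ ^ 2 := by
  rw [Improving, extend_old, hy, inner_pad, mul_zero, mul_zero, add_zero, add_zero]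

theorem improving_new {y : EuclideanSpace ℝ (Fin (D + 1 + 2))}
    {a : EuclideanSpace ℝ (Fin (D + 1))} {b c : ℝ} (hy : y = pad a b c) :
    (Improving (extend Q) y (newIdx N 0) ↔ inner ℝ a (minNormPoint Q) / 2 +
      b * (supNorm (minNormPoint Q) / 4) + c * maxOneNorm Q < ‖y‖ ^ 2) ∧
    (Improving (extend Q) y (newIdx N 1) ↔ inner ℝ a (minNormPoint Q) / 2 +
      b * (supNorm (minNormPoint Q) / 4) - c * (maxOneNorm Q + 1) < ‖y‖ ^ 2) ∧
    (Improving (extend Q) y (newIdx N 2) ↔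
      b * (supNorm (minNormPoint Q) / 4) + c * (maxOneNorm Q + 2) < ‖y‖ ^ 2) ∧
    (Improving (extend Q) y (newIdx N 3) ↔
      b * (supNorm (minNormPoint Q) / 4) - c * (maxOneNorm Q + 3) < ‖y‖ ^ 2) := by
  simp only [Improving, extend_new_zero, extend_new_one, extend_new_two, extend_new_three, hy,
    inner_pad, inner_smul_right, inner_zero_right]
  refine ⟨?_, ?_, ?_, ?_⟩ <;> refine iff_of_eq (congrArg (· < _) ?_) <;> ring

/-- The norms of the points increase from the old ones to the new ones, and along these. -/
theorem Good.norm_lt (hQ : Good Q) :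
    (∀ i, ‖extend Q (oldEmb N i)‖ < ‖extend Q (newIdx N 0)‖) ∧
    ‖extend Q (newIdx N 0)‖ < ‖extend Q (newIdx N 1)‖ ∧
    ‖extend Q (newIdx N 1)‖ < ‖extend Q (newIdx N 2)‖ ∧
    ‖extend Q (newIdx N 2)‖ < ‖extend Q (newIdx N 3)‖ := by
  obtain ⟨hX, hX1, hm, hmX, hM, hXM⟩ := hQ.bounds
  have hs : ‖(1 / 2 : ℝ) • minNormPoint Q‖ ^ 2 = ‖minNormPoint Q‖ ^ 2 / 4 := by
    rw [norm_smul, mul_pow]; norm_num; ring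
  refine ⟨fun i => ?_, ?_, ?_, ?_⟩
  · refine lt_of_pow_lt_pow_left₀ 2 (norm_nonneg _) ?_
    rw [extend_old, extend_new_zero, norm_sq_pad, norm_sq_pad, hs]
    have := pow_le_pow_left₀ (norm_nonneg _) (norm_le_maxOneNorm Q i) 2
    nlinarith
  · refine lt_of_pow_lt_pow_left₀ 2 (norm_nonneg _) ?_
    rw [extend_new_zero, extend_new_one, norm_sq_pad, norm_sq_pad]
    nlinarith
  -- The old coordinates of q contribute X/4 ≤ 1/4, which is less than the gain from (M + 1)² to (M
  -- + 2)².
  · refine lt_of_pow_lt_pow_left₀ 2 (norm_nonneg _) ?_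
    rw [extend_new_one, extend_new_two, norm_sq_pad, norm_sq_pad, hs, norm_zero]
    nlinarith
  · refine lt_of_pow_lt_pow_left₀ 2 (norm_nonneg _) ?_
    rw [extend_new_two, extend_new_three, norm_sq_pad, norm_sq_pad]
    nlinarith

end Extend

/-! ### Affine minimizers in the four intermediate stages -/

section Stages

variable {N D : ℕ} {Q : Fin (N + 1) → EuclideanSpace ℝ (Fin (D + 1))}

theorem oldEmb_mem_map_union {C : Finset (Fin (N + 1))} {B : Finset (Fin (N + 1 + 4))}
    (hB : ∀ i, oldEmb N i ∉ B) {i : Fin (N + 1)} :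
    oldEmb N i ∈ C.map (oldEmb N) ∪ B ↔ i ∈ C := by
  simp [Finset.mem_union, hB]

theorem newIdx_mem_map_union {C : Finset (Fin (N + 1))} {B : Finset (Fin (N + 1 + 4))}
    {a : Fin 4} : newIdx N a ∈ C.map (oldEmb N) ∪ B ↔ newIdx N a ∈ B := by
  rw [Finset.mem_union, or_iff_right (newIdx_notMem_map C a)]

theorem newIdx_eq_iff {a b : Fin 4} : newIdx N a = newIdx N b ↔ a = b :=
  (newIdx_injective N).eq_iff

/-- The affine minimizer of an optimal corral together with the first new point. -/
theorem coeffs_zero (hQ : Good Q) {O : Finset (Fin (N + 1))} {μ : Fin (N + 1) → ℝ}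
    (hO : AffIndepOn Q O) (hne : O.Nonempty) (hμ : IsAffineCoeffs Q O μ)
    (hx : comb Q O μ = minNormPoint Q) {α : Fin (N + 1 + 4) → ℝ}
    (hα : IsAffineCoeffs (extend Q) (O.map (oldEmb N) ∪ {newIdx N 0}) α) :
    0 < α (newIdx N 0) ∧ α (newIdx N 0) < 1 ∧
      (∀ i ∈ O, α (oldEmb N i) = (1 - α (newIdx N 0)) * μ i) ∧
      comb (extend Q) (O.map (oldEmb N) ∪ {newIdx N 0}) α =
        pad ((1 - α (newIdx N 0) / 2) • minNormPoint Q)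
          (α (newIdx N 0) * (supNorm (minNormPoint Q) / 4))
          (α (newIdx N 0) * maxOneNorm Q) := by
  obtain ⟨hX, hX1, hm, hmX, hM, hXM⟩ := hQ.bounds
  have hB : ∀ i, oldEmb N i ∉ ({newIdx N 0} : Finset (Fin (N + 1 + 4))) := fun i => by
    simpa using oldEmb_ne_newIdx i 0
  have hz : ∀ a : Fin 4, a ≠ 0 → α (newIdx N a) = 0 := fun a ha =>
    hα.eq_zero _ (by rw [newIdx_mem_map_union, Finset.mem_singleton, newIdx_eq_iff]; exact ha)
  have h1 := hz 1 (by decide)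
  have h2 := hz 2 (by decide)
  have h3 := hz 3 (by decide)
  have hold : ∀ i, i ∉ O → α (oldEmb N i) = 0 := fun i hi =>
    hα.eq_zero _ (by rwa [oldEmb_mem_map_union hB])
  set t := α (newIdx N 0) with ht
  have hsum := hα.sum_eq_one
  rw [sum_extend hα.eq_zero, h1, h2, h3, ← ht,
    ← Finset.sum_subset (Finset.subset_univ O) fun i _ hi => hold i hi] at hsum
  have hcomb := comb_extend Q hα.eq_zero
  rw [h1, h2, h3, ← ht, ← comb_eq_sum hold] at hcomb
  obtain ⟨e1, e2, -, -, -⟩ := extend_coeffs hα hcomb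
  have e1' : ∀ i ∈ O, _ := fun i hi => e1 i ((oldEmb_mem_map_union hB).2 hi)
  have e2' := e2 (by rw [newIdx_mem_map_union, Finset.mem_singleton])
  have hxO : ∀ i ∈ O, inner ℝ (minNormPoint Q) (Q i) = ‖minNormPoint Q‖ ^ 2 := by
    rw [← hx]; exact (isAffineCoeffs_iff.1 hμ).2.2
  -- `β` is the deviation from the expected weights (1 - t)μ. Its total is 0, so its combination is
  -- orthogonal both to x* and to the old part of the minimizer. These two differ, up to a multiple
  -- of x*, by that combination, which is therefore 0; independence of `O` gives β = 0.
  set β : Fin (N + 1) → ℝ := fun i => α (oldEmb N i) - (1 - t) * μ i with hβ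
  have hβsum : ∑ i ∈ O, β i = 0 := by
    rw [hβ, Finset.sum_sub_distrib, ← Finset.mul_sum, hμ.sum_eq_one]
    linarith
  have hβcomb : comb Q O β = comb Q O (fun i => α (oldEmb N i)) - (1 - t) • minNormPoint Q := by
    rw [← hx]
    simp only [comb, hβ, sub_smul, mul_smul, Finset.sum_sub_distrib, Finset.smul_sum]
  have g1 := inner_comb_of_const (w := β) e1'
  have g2 := inner_comb_of_const (w := β) hxO
  rw [hβsum, zero_mul] at g1 g2
  set x := minNormPoint Q with hxdef
  set V := comb Q O (fun i => α (oldEmb N i)) with hV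
  have hd : V + ((t + 0) / 2) • x = comb Q O β + (1 - t / 2) • x := by
    rw [hβcomb]; module
  rw [hd, inner_add_left, inner_smul_left, g2, real_inner_self_eq_norm_sq] at g1
  have hβ0 : comb Q O β = 0 := by
    rw [← norm_eq_zero, ← sq_eq_zero_iff]
    simpa using g1
  rw [hβ0, zero_add] at hd
  rw [hd] at hcomb e1' e2'
  have hcoef := hO β hβsum hβ0
  obtain ⟨i, hi⟩ := hne
  have e3 := e1' i hi
  rw [← e3, inner_smul_left, inner_smul_left, hxO i hi, real_inner_self_eq_norm_sq] at e2'
  simp only [conj_trivial] at e2'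
  set X := ‖x‖ ^ 2
  set m := supNorm x
  set M := maxOneNorm Q
  -- The equations at p and at an old point together determine t. Then t < 1 because M² ≥ X.
  have key : t * (X / 4 + m ^ 2 / 16 + M ^ 2) = X / 2 := by
    linarith only [e2']
  have hpos : 0 < X / 4 + m ^ 2 / 16 + M ^ 2 := by positivity
  have ht0 : 0 < t := by
    by_contra h
    have := mul_nonpos_of_nonpos_of_nonneg (not_lt.1 h) hpos.le
    linarith
  refine ⟨ht0, ?_, fun j hj => ?_, ?_⟩
  · by_contra h
    have h1 := mul_le_mul_of_nonneg_right (not_lt.1 h) hpos.le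
    linarith only [h1, key, hXM, hX, sq_nonneg m]
  · have := hcoef j hj
    rw [hβ] at this
    linarith
  · rw [hcomb]
    congr 1 <;> ring

/-- Once the second new point has been added, the old points have to leave. -/
theorem coeffs_zero_one (hQ : Good Q) {A : Finset (Fin (N + 1))}
    (hA : ∀ i ∈ A, inner ℝ (minNormPoint Q) (Q i) = ‖minNormPoint Q‖ ^ 2)
    {α : Fin (N + 1 + 4) → ℝ}
    (hα : IsAffineCoeffs (extend Q) (A.map (oldEmb N) ∪ {newIdx N 0, newIdx N 1}) α) :
    0 < α (newIdx N 0) ∧ 0 < α (newIdx N 1) ∧ (A.Nonempty → ∃ i ∈ A, α (oldEmb N i) ≤ 0) ∧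
      α (newIdx N 0) * maxOneNorm Q = α (newIdx N 1) * (maxOneNorm Q + 1) := by
  obtain ⟨hX, hX1, hm, hmX, hM, hXM⟩ := hQ.bounds
  have hB : ∀ i, oldEmb N i ∉ ({newIdx N 0, newIdx N 1} : Finset (Fin (N + 1 + 4))) := fun i => by
    simpa using ⟨oldEmb_ne_newIdx i 0, oldEmb_ne_newIdx i 1⟩
  have hz : ∀ a : Fin 4, a ≠ 0 → a ≠ 1 → α (newIdx N a) = 0 := fun a ha ha' =>
    hα.eq_zero _ (by
      rw [newIdx_mem_map_union, Finset.mem_insert, Finset.mem_singleton, newIdx_eq_iff,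
        newIdx_eq_iff]
      tauto)
  have h2 := hz 2 (by decide) (by decide)
  have h3 := hz 3 (by decide) (by decide)
  have hold : ∀ i, i ∉ A → α (oldEmb N i) = 0 := fun i hi =>
    hα.eq_zero _ (by rwa [oldEmb_mem_map_union hB])
  have hsum := hα.sum_eq_one
  rw [sum_extend hα.eq_zero, h2, h3,
    ← Finset.sum_subset (Finset.subset_univ A) fun i _ hi => hold i hi] at hsum
  have hcomb := comb_extend Q hα.eq_zero
  rw [h2, h3, ← comb_eq_sum hold] at hcomb
  obtain ⟨-, e1, e2, -, -⟩ := extend_coeffs hα hcomb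
  have e1' := e1 (by rw [newIdx_mem_map_union]; simp)
  have e2' := e2 (by rw [newIdx_mem_map_union]; simp)
  have hVx := inner_comb_of_const (w := fun i => α (oldEmb N i)) hA
  have hge : A.Nonempty → ∑ i ∈ A, α (oldEmb N i) ≤ 0 → ∃ i ∈ A, α (oldEmb N i) ≤ 0 := by
    intro hne hle
    by_contra h
    push Not at h
    exact absurd (Finset.sum_pos h hne) (not_lt.2 hle)
  set x := minNormPoint Q
  set V := comb Q A (fun i => α (oldEmb N i))
  set S := ∑ i ∈ A, α (oldEmb N i)
  set u := α (newIdx N 0)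
  set v := α (newIdx N 1)
  -- The equations at p and q differ only in the term with the last coordinate c, so c(2M + 1) = 0.
  have hc : u * maxOneNorm Q - v * (maxOneNorm Q + 1) = 0 := by
    have : (u * maxOneNorm Q - v * (maxOneNorm Q + 1) + 0 * (maxOneNorm Q + 2) -
      0 * (maxOneNorm Q + 3)) * (2 * maxOneNorm Q + 1) = 0 := by linarith
    rcases mul_eq_zero.1 this with h | h
    · linarith
    · linarith
  have hax : inner ℝ (V + ((u + v) / 2) • x) x = (1 - (u + v) / 2) * ‖x‖ ^ 2 := by
    rw [inner_add_left, real_inner_comm, hVx, inner_smul_left, real_inner_self_eq_norm_sq]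
    simp only [conj_trivial]
    have : S = 1 - (u + v) := by linarith
    rw [this]; ring
  -- Combined with the equation at p, this square and that of (u + v - 1)m/4 give (u + v - 1)(X/4 -
  -- m²/16) ≥ 0. As m² ≤ X, p and q carry weight at least 1, and the old points at most 0. No
  -- independence is used, so this applies to every subset left over during the minor cycles.
  have hsq : 0 ≤ ‖V + ((u + v) / 2) • x - (1 / 2 : ℝ) • x‖ ^ 2 := sq_nonneg _
  rw [norm_sub_sq_real, inner_smul_right, hax, norm_smul, mul_pow] at hsq
  rw [hax] at e1'
  generalize hY : ‖V + ((u + v) / 2) • x‖ ^ 2 = Y at *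
  set X := ‖x‖ ^ 2
  set m := supNorm x
  set M := maxOneNorm Q
  have hhalf : ‖(1 / 2 : ℝ)‖ ^ 2 = 1 / 4 := by norm_num
  rw [hhalf] at hsq
  have hc' : u * M - v * (M + 1) + 0 * (M + 2) - 0 * (M + 3) = 0 := by linarith
  rw [hc'] at e1'
  have hb : (0 : ℝ) ≤ ((u + v - 1) * (m / 4)) ^ 2 := sq_nonneg _
  have ht : 0 ≤ (u + v - 1) * (X / 4 - m ^ 2 / 16) := by
    linarith only [hsq, hb, e1']
  have hpos : 0 < X / 4 - m ^ 2 / 16 := by linarith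
  have ht1 : 1 ≤ u + v := by
    by_contra h
    push Not at h
    have := mul_neg_of_neg_of_pos (show u + v - 1 < 0 by linarith) hpos
    linarith
  have hu : 0 < u := by
    by_contra h
    push Not at h
    have h1 := mul_nonpos_of_nonpos_of_nonneg h hM.le
    have h2 := mul_pos (show 0 < v by linarith) (show 0 < M + 1 by linarith)
    linarith
  have hv : 0 < v := by
    by_contra h
    push Not at h
    have h1 := mul_nonpos_of_nonpos_of_nonneg h (show 0 ≤ M + 1 by linarith)
    have h2 := mul_pos hu hM
    linarith
  exact ⟨hu, hv, fun hne => hge hne (by linarith), by linarith⟩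

/-- Once the third new point has been added to the first two, the first one has to leave. -/
theorem coeffs_one_two (hQ : Good Q) {A : Finset (Fin (N + 1 + 4))} (hA : A ⊆ {newIdx N 0})
    {α : Fin (N + 1 + 4) → ℝ}
    (hα : IsAffineCoeffs (extend Q) (A ∪ {newIdx N 1, newIdx N 2}) α) :
    0 < α (newIdx N 1) ∧ 0 < α (newIdx N 2) ∧ (A.Nonempty → α (newIdx N 0) ≤ 0) ∧
      (A = ∅ → ∃ t h : ℝ, 0 < t ∧ 0 < h ∧
        comb (extend Q) (A ∪ {newIdx N 1, newIdx N 2}) α =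
          pad ((t / 2) • minNormPoint Q) (supNorm (minNormPoint Q) / 4) h ∧
        ‖comb (extend Q) (A ∪ {newIdx N 1, newIdx N 2}) α‖ ^ 2 ≤
          (t / 2) * ‖minNormPoint Q‖ ^ 2) := by
  obtain ⟨hX, hX1, hm, hmX, hM, hXM⟩ := hQ.bounds
  have hAold : ∀ i, oldEmb N i ∉ A := fun i hi =>
    oldEmb_ne_newIdx i 0 (Finset.mem_singleton.1 (hA hi))
  have hAnew : ∀ a : Fin 4, a ≠ 0 → newIdx N a ∉ A := fun a ha hi =>
    ha (newIdx_eq_iff.1 (Finset.mem_singleton.1 (hA hi)))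
  have hold : ∀ i, α (oldEmb N i) = 0 := fun i => hα.eq_zero _ (by
    simp [hAold, oldEmb_ne_newIdx])
  have h3 : α (newIdx N 3) = 0 := hα.eq_zero _ (by
    simp [hAnew, newIdx_eq_iff])
  have hsum := hα.sum_eq_one
  rw [sum_extend hα.eq_zero, h3] at hsum
  simp only [hold, Finset.sum_const_zero] at hsum
  have hcomb := comb_extend Q hα.eq_zero
  rw [h3] at hcomb
  simp only [hold, zero_smul, Finset.sum_const_zero, zero_add] at hcomb
  obtain ⟨-, e0, e1, e2, -⟩ := extend_coeffs hα hcomb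
  have e1' := e1 (by simp)
  have e2' := e2 (by simp)
  have hnorm := norm_sq_pad (((α (newIdx N 0) + α (newIdx N 1)) / 2) • minNormPoint Q)
    ((α (newIdx N 0) + α (newIdx N 1) + α (newIdx N 2) + 0) * (supNorm (minNormPoint Q) / 4))
    (α (newIdx N 0) * maxOneNorm Q - α (newIdx N 1) * (maxOneNorm Q + 1) +
      α (newIdx N 2) * (maxOneNorm Q + 2) - 0 * (maxOneNorm Q + 3))
  rw [← hcomb, ← e2'] at hnorm
  rw [inner_smul_left, real_inner_self_eq_norm_sq, ← e2'] at e1' e0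
  simp only [conj_trivial] at e1' e0
  set x := minNormPoint Q
  set u := α (newIdx N 0) with hu
  set v := α (newIdx N 1)
  set w := α (newIdx N 2)
  set X := ‖x‖ ^ 2
  set m := supNorm x
  set M := maxOneNorm Q
  rcases Finset.subset_singleton_iff.1 hA with h0 | h0
  · have hu0 : u = 0 := hα.eq_zero _ (by simp [h0, newIdx_eq_iff])
    rw [hu0] at e1' hsum hcomb hnorm
    have hw : w = 1 - v := by linarith
    rw [hw] at e1' hcomb hnorm ⊢
    have key : v * (X / 4 + (2 * M + 3) ^ 2) = (M + 2) * (2 * M + 3) := by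
      linarith only [e1']
    have hpos : 0 < X / 4 + (2 * M + 3) ^ 2 := by positivity
    have hv0 : 0 < v := by
      by_contra h
      have h1 := mul_nonpos_of_nonpos_of_nonneg (not_lt.1 h) hpos.le
      linarith only [h1, key, hM, sq_nonneg M]
    have hv1 : 0 < 1 - v := by
      by_contra h
      have h1 := mul_le_mul_of_nonneg_right (show 1 ≤ v by linarith) hpos.le
      linarith only [h1, key, hM, hX, sq_nonneg M]
    refine ⟨hv0, hv1, fun hne => absurd h0 hne.ne_empty, fun _ =>
      ⟨v, (M + 2) - v * (2 * M + 3), hv0, ?_, ?_, ?_⟩⟩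
    · have : 0 < ((M + 2) - v * (2 * M + 3)) * (X / 4 + (2 * M + 3) ^ 2) := by
        have : ((M + 2) - v * (2 * M + 3)) * (X / 4 + (2 * M + 3) ^ 2) = (M + 2) * (X / 4) := by
          linear_combination -(2 * M + 3) * key
        rw [this]; positivity
      exact (mul_pos_iff_of_pos_right hpos).1 this
    · rw [hcomb]
      congr 1
      · rw [zero_add]
      · ring
      · ring
    · rw [hnorm]
      have hk : ((M + 2) - v * (2 * M + 3)) * (2 * M + 3) = v * (X / 4) := by
        linear_combination -key
      have hh : 0 < (M + 2) - v * (2 * M + 3) := by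
        refine (mul_pos_iff_of_pos_right (show 0 < 2 * M + 3 by linarith)).1 ?_
        rw [hk]; positivity
      have h5 := mul_le_mul_of_nonneg_left (show M + 2 ≤ 2 * M + 3 by linarith) hh.le
      -- With h = (M + 2) - v(2M + 3) the last coordinate, the squared norm is m²/16 + h(M + 2) ≤
      -- X/16 + vX/4. The required bound vX/2 thus follows from v ≥ 1/4, which rests on X ≤ 1.
      have h6 : 1 / 4 ≤ v := by
        by_contra h
        have h1 := mul_lt_mul_of_pos_right (not_le.1 h) hpos
        linarith only [h1, key, hX1, hM, sq_nonneg M]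
      have h7 := mul_le_mul_of_nonneg_right h6 hX.le
      linarith only [h5, h7, hk, hmX]
  · have e0' := e0 (by simp [h0])
    have hc : u * M - v * (M + 1) + w * (M + 2) - 0 * (M + 3) = 0 := by
      have : (u * M - v * (M + 1) + w * (M + 2) - 0 * (M + 3)) * (2 * M + 1) = 0 := by
        linarith only [e0', e1']
      exact (mul_eq_zero.1 this).resolve_right (by linarith)
    rw [hc] at e0'
    -- For {p, q, r} the last coordinate is 0, and comparing p with r leaves u + v = 0. So r has
    -- weight 1, and cancelling its last coordinate forces u(2M + 1) = -(M + 2).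
    have huv : (u + v) * X = 0 := by linarith only [e0']
    have huv' := (mul_eq_zero.1 huv).resolve_right hX.ne'
    have hw : w = 1 := by linarith
    have hv : v = -u := by linarith
    rw [hw, hv] at hc
    have hu0 : u < 0 := by
      by_contra h
      have := mul_nonneg (not_lt.1 h) (show 0 ≤ 2 * M + 1 by linarith)
      linarith
    exact ⟨by linarith, by linarith, fun _ => hu0.le, fun h => by simp [h] at h0⟩

/-- Once the last new point has been added to the second and the third one, the second one has to
leave. -/
theorem coeffs_two_three (hQ : Good Q) {A : Finset (Fin (N + 1 + 4))} (hA : A ⊆ {newIdx N 1})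
    {α : Fin (N + 1 + 4) → ℝ}
    (hα : IsAffineCoeffs (extend Q) (A ∪ {newIdx N 2, newIdx N 3}) α) :
    0 < α (newIdx N 2) ∧ 0 < α (newIdx N 3) ∧ α (newIdx N 1) = 0 ∧
      comb (extend Q) (A ∪ {newIdx N 2, newIdx N 3}) α =
        pad 0 (supNorm (minNormPoint Q) / 4) 0 := by
  obtain ⟨hX, hX1, hm, hmX, hM, hXM⟩ := hQ.bounds
  have hAold : ∀ i, oldEmb N i ∉ A := fun i hi =>
    oldEmb_ne_newIdx i 1 (Finset.mem_singleton.1 (hA hi))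
  have hAnew : ∀ a : Fin 4, a ≠ 1 → newIdx N a ∉ A := fun a ha hi =>
    ha (newIdx_eq_iff.1 (Finset.mem_singleton.1 (hA hi)))
  have hold : ∀ i, α (oldEmb N i) = 0 := fun i => hα.eq_zero _ (by
    simp [hAold, oldEmb_ne_newIdx])
  have h0 : α (newIdx N 0) = 0 := hα.eq_zero _ (by
    simp [hAnew, newIdx_eq_iff])
  have hsum := hα.sum_eq_one
  rw [sum_extend hα.eq_zero, h0] at hsum
  simp only [hold, Finset.sum_const_zero] at hsum
  have hcomb := comb_extend Q hα.eq_zero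
  rw [h0] at hcomb
  simp only [hold, zero_smul, Finset.sum_const_zero, zero_add] at hcomb
  obtain ⟨-, -, e1, e2, e3⟩ := extend_coeffs hα hcomb
  have e2' := e2 (by simp)
  have e3' := e3 (by simp)
  rw [← e3', inner_smul_left, real_inner_self_eq_norm_sq] at e1
  simp only [conj_trivial] at e1
  set x := minNormPoint Q
  set v := α (newIdx N 1) with hv
  set w := α (newIdx N 2)
  set z := α (newIdx N 3)
  set X := ‖x‖ ^ 2
  set m := supNorm x
  set M := maxOneNorm Q
  have hc : 0 * M - v * (M + 1) + w * (M + 2) - z * (M + 3) = 0 := by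
    have : (0 * M - v * (M + 1) + w * (M + 2) - z * (M + 3)) * (2 * M + 5) = 0 := by
      linarith only [e2', e3']
    exact (mul_eq_zero.1 this).resolve_right (by linarith)
  -- The minimizer (0, m/4, 0) of {r, s} is already that of {q, r, s}, so q gets weight exactly 0.
  -- This suffices for its removal, because the method requires strictly positive weights.
  have hv0 : v = 0 := by
    rcases Finset.subset_singleton_iff.1 hA with hA0 | hA0
    · exact hα.eq_zero _ (by simp [hA0, newIdx_eq_iff])
    · have e1' := e1 (by simp [hA0])
      rw [hc] at e1'
      have : v * X = 0 := by linarith only [e1']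
      exact (mul_eq_zero.1 this).resolve_right hX.ne'
  rw [hc, hv0] at hcomb
  rw [hv0] at hsum hc
  have hz : z = 1 - w := by linarith
  rw [hz] at hc hcomb ⊢
  have hw : w * (2 * M + 5) = M + 3 := by linarith only [hc]
  have hw' : (1 - w) * (2 * M + 5) = M + 2 := by linarith only [hc]
  refine ⟨(mul_pos_iff_of_pos_right (show 0 < 2 * M + 5 by linarith)).1 (by linarith),
    (mul_pos_iff_of_pos_right (show 0 < 2 * M + 5 by linarith)).1 (by linarith), hv0, ?_⟩
  rw [hcomb]
  congr 1
  · simp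
  · ring

end Stages

/-! ### Simulation of the smaller run, without companions or with r and s -/

section Lift

variable {N D : ℕ} {Q : Fin (N + 1) → EuclideanSpace ℝ (Fin (D + 1))}

/-- The coefficients `α` scaled by `τ`, with the remaining weight on the last two new points,
distributed such that the last coordinates cancel. -/
noncomputable def lift (M τ : ℝ) (α : Fin (N + 1) → ℝ) : Fin (N + 1 + 4) → ℝ :=
  Fin.append (fun i => τ * α i)
    ![0, 0, (1 - τ) * ((M + 3) / (2 * M + 5)), (1 - τ) * ((M + 2) / (2 * M + 5))]

section

variable (M τ : ℝ) (α : Fin (N + 1) → ℝ)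

@[simp] theorem lift_old (i : Fin (N + 1)) : lift M τ α (oldEmb N i) = τ * α i := by
  simp [lift, oldEmb]

@[simp] theorem lift_zero : lift M τ α (newIdx N 0) = 0 := by
  simp [lift, newIdx]

@[simp] theorem lift_one : lift M τ α (newIdx N 1) = 0 := by
  simp [lift, newIdx]

@[simp] theorem lift_two :
    lift M τ α (newIdx N 2) = (1 - τ) * ((M + 3) / (2 * M + 5)) := by
  simp [lift, newIdx]

@[simp] theorem lift_three :
    lift M τ α (newIdx N 3) = (1 - τ) * ((M + 2) / (2 * M + 5)) := by
  simp [lift, newIdx]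

end

theorem eq_lift {M τ : ℝ} {α : Fin (N + 1) → ℝ} {β : Fin (N + 1 + 4) → ℝ}
    (h : ∀ i, β (oldEmb N i) = τ * α i) (h0 : β (newIdx N 0) = 0) (h1 : β (newIdx N 1) = 0)
    (h2 : β (newIdx N 2) = (1 - τ) * ((M + 3) / (2 * M + 5)))
    (h3 : β (newIdx N 3) = (1 - τ) * ((M + 2) / (2 * M + 5))) : β = lift M τ α := by
  funext j
  rcases idx_cases j with ⟨i, rfl⟩ | rfl | rfl | rfl | rfl
  · rw [h, lift_old]
  · rw [h0, lift_zero]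
  · rw [h1, lift_one]
  · rw [h2, lift_two]
  · rw [h3, lift_three]

/-- `lift` is affine in the pair (τ, τα), so mixing lifts gives a lift; normalizing the old part by
its scale turns θ into a projectively changed parameter. -/
theorem lift_mix {M τ₁ τ₂ θ : ℝ} (α lam : Fin (N + 1) → ℝ)
    (h : θ * τ₁ + (1 - θ) * τ₂ ≠ 0) :
    (fun j => θ * lift M τ₁ α j + (1 - θ) * lift M τ₂ lam j) =
      lift M (θ * τ₁ + (1 - θ) * τ₂) fun i =>
        (θ * τ₁ / (θ * τ₁ + (1 - θ) * τ₂)) * α i +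
          (1 - θ * τ₁ / (θ * τ₁ + (1 - θ) * τ₂)) * lam i := by
  refine eq_lift (fun i => ?_) ?_ ?_ ?_ ?_
  · rw [lift_old, lift_old]
    field_simp
    ring
  · simp
  · simp
  · rw [lift_two, lift_two]; ring
  · rw [lift_three, lift_three]; ring

theorem Good.comb_ne_zero (hQ : Good Q) {C : Finset (Fin (N + 1))} {α : Fin (N + 1) → ℝ}
    (h0 : ∀ i ∈ C, 0 ≤ α i) (h1 : ∑ i ∈ C, α i = 1) : comb Q C α ≠ 0 := by
  intro h
  have := le_inner_of_mem_convexHull (minNormPoint_inner Q) (comb_mem_convexHull h0 h1)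
  rw [h, inner_zero_right] at this
  exact absurd hQ.bounds.1 (not_lt.2 this)

/-- The two sets of new points that accompany the old points. -/
def IsCompanion (A : Finset (Fin (N + 1 + 4))) : Prop :=
  A = ∅ ∨ A = {newIdx N 2, newIdx N 3}

theorem IsCompanion.oldEmb_notMem {A : Finset (Fin (N + 1 + 4))} (hA : IsCompanion A)
    (i : Fin (N + 1)) : oldEmb N i ∉ A := by
  rcases hA with rfl | rfl
  · simp
  · simp [oldEmb_ne_newIdx]

/-- Affine coefficients for old points and their companions come from affine coefficients of the
old points. -/
theorem exists_lift (hQ : Good Q) {A : Finset (Fin (N + 1 + 4))} (hA : IsCompanion A)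
    {C : Finset (Fin (N + 1))} (hC : C.Nonempty) {β : Fin (N + 1 + 4) → ℝ}
    (hβ : IsAffineCoeffs (extend Q) (C.map (oldEmb N) ∪ A) β) :
    ∃ (τ : ℝ) (α : Fin (N + 1) → ℝ), 0 < τ ∧ τ ≤ 1 ∧ β = lift (maxOneNorm Q) τ α ∧
      IsAffineCoeffs Q C α ∧ (A = ∅ ∨ (τ = 1 → comb Q C α = 0)) := by
  obtain ⟨hX, hX1, hm, hmX, hM, hXM⟩ := hQ.bounds
  have hold : ∀ i, i ∉ C → β (oldEmb N i) = 0 := fun i hi =>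
    hβ.eq_zero _ (by rwa [oldEmb_mem_map_union hA.oldEmb_notMem])
  have hmem : ∀ i ∈ C, oldEmb N i ∈ C.map (oldEmb N) ∪ A := fun i hi =>
    (oldEmb_mem_map_union hA.oldEmb_notMem).2 hi
  have hsum := hβ.sum_eq_one
  have hcomb := comb_extend Q hβ.eq_zero
  rw [sum_extend hβ.eq_zero,
    ← Finset.sum_subset (Finset.subset_univ C) fun i _ hi => hold i hi] at hsum
  rw [← comb_eq_sum hold] at hcomb
  rcases hA with rfl | rfl
  · have hz : ∀ a, β (newIdx N a) = 0 := fun a =>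
      hβ.eq_zero _ (by rw [newIdx_mem_map_union]; simp)
    simp only [hz, add_zero, zero_mul, sub_zero, zero_div, zero_smul] at hcomb hsum
    have e1 := (extend_coeffs hβ hcomb).1
    refine ⟨1, fun i => β (oldEmb N i), one_pos, le_rfl, ?_, ?_, Or.inl rfl⟩
    · refine eq_lift (fun i => ?_) ?_ ?_ ?_ ?_ <;> simp [hz]
    · refine isAffineCoeffs_iff.2 ⟨hold, hsum, fun i hi => ?_⟩
      rw [e1 i (hmem i hi)]
      ring
  · have h0 : β (newIdx N 0) = 0 := hβ.eq_zero _ (by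
      rw [newIdx_mem_map_union]; simp [newIdx_eq_iff])
    have h1 : β (newIdx N 1) = 0 := hβ.eq_zero _ (by
      rw [newIdx_mem_map_union]; simp [newIdx_eq_iff])
    rw [h0, h1] at hcomb hsum
    simp only [add_zero, zero_add, zero_mul, sub_zero, zero_div, zero_smul] at hcomb hsum
    obtain ⟨e1, -, -, e2, e3⟩ := extend_coeffs hβ hcomb
    have e2' := e2 (by rw [newIdx_mem_map_union]; simp)
    have e3' := e3 (by rw [newIdx_mem_map_union]; simp)
    have e1' : ∀ i ∈ C, _ := fun i hi => e1 i (hmem i hi)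
    set V := comb Q C fun i => β (oldEmb N i) with hV
    set T := ∑ i ∈ C, β (oldEmb N i) with hT
    -- Let k be the common value in the equations, i.e. the squared norm. Weighting those at the old
    -- points gives ‖V‖² = Tk, and the one at r gives k = (1 - T)m²/16 once c = 0. Hence T(1 - T) ≥
    -- 0, and T = 0 would give V = 0 and so k = 0, which contradicts k = m²/16. Dividing by T then
    -- yields ⟪V/T, Q i⟫ = k/T = ‖V/T‖².
    have hVV := inner_comb_of_const (w := fun i => β (oldEmb N i)) e1'
    rw [← hV, ← hT, real_inner_self_eq_norm_sq] at hVV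
    set w := β (newIdx N 2)
    set z := β (newIdx N 3)
    generalize hY : ‖V‖ ^ 2 = Y at *
    set m := supNorm (minNormPoint Q)
    set M := maxOneNorm Q
    have hc : w * (M + 2) - z * (M + 3) = 0 := by
      have : (w * (M + 2) - z * (M + 3)) * (2 * M + 5) = 0 := by linarith only [e2', e3']
      exact (mul_eq_zero.1 this).resolve_right (by linarith)
    rw [hc] at e1' e2' hVV
    have hwz : w + z = 1 - T := by linarith
    rw [hwz] at e1' e2' hVV
    have hY0 : 0 ≤ Y := hY ▸ sq_nonneg _
    have hk : Y + ((1 - T) * (m / 4)) ^ 2 + 0 ^ 2 = (1 - T) * (m ^ 2 / 16) := by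
      linarith only [e2']
    rw [hk] at e1' hVV
    have hT0 : T ≠ 0 := by
      intro hT0
      rw [hT0, zero_mul] at hVV
      have hV0 : V = 0 := by
        rw [← norm_eq_zero, ← sq_eq_zero_iff, hY, hVV]
      obtain ⟨i, hi⟩ := hC
      have := e1' i hi
      rw [hV0, inner_zero_left, hT0] at this
      have : 0 < m ^ 2 / 16 := by positivity
      linarith
    have hT01 : 0 ≤ T * (1 - T) := by
      have : 0 ≤ T * (1 - T) * (m ^ 2 / 16) := by linarith
      exact nonneg_of_mul_nonneg_left this (by positivity)
    have hT1 : 0 < T ∧ T ≤ 1 := by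
      constructor
      · by_contra h
        have hlt : T < 0 := lt_of_le_of_ne (not_lt.1 h) hT0
        have := mul_neg_of_neg_of_pos hlt (show 0 < 1 - T by linarith)
        linarith
      · by_contra h
        have := mul_neg_of_pos_of_neg (show 0 < T by linarith) (show 1 - T < 0 by linarith)
        linarith
    have h5 : 2 * M + 5 ≠ 0 := by linarith
    have hcV : comb Q C (fun i => T⁻¹ * β (oldEmb N i)) = T⁻¹ • V := by
      simp only [hV, comb, Finset.smul_sum, mul_smul]
    refine ⟨T, fun i => T⁻¹ * β (oldEmb N i), hT1.1, hT1.2, ?_, ?_, Or.inr ?_⟩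
    · refine eq_lift (fun i => ?_) h0 h1 ?_ ?_
      · field_simp
      · field_simp
        linear_combination hc + (M + 3) * hwz
      · field_simp
        linear_combination (M + 2) * hwz - hc
    · refine isAffineCoeffs_iff.2 ⟨fun i hi => ?_, ?_, fun i hi => ?_⟩
      · rw [hold i hi, mul_zero]
      · rw [← Finset.mul_sum, ← hT, inv_mul_cancel₀ hT0]
      · rw [hcV, inner_smul_left, e1' i hi, norm_smul, mul_pow, hY, hVV]
        simp only [conj_trivial, Real.norm_eq_abs, sq_abs]
        field_simp
    · intro hT1
      rw [hT1] at hVV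
      have : V = 0 := by
        rw [← norm_eq_zero, ← sq_eq_zero_iff, hY, hVV]
        ring
      rw [hcV, this, smul_zero]

/-- The state `s'` on the extended family consists of the state `s` on the smaller family,
together with the companions `A`. -/
structure Lifted (Q : Fin (N + 1) → EuclideanSpace ℝ (Fin (D + 1)))
    (A : Finset (Fin (N + 1 + 4))) (s : State (Fin (N + 1))) (s' : State (Fin (N + 1 + 4))) :
    Prop where
  C_eq : s'.C = s.C.map (oldEmb N) ∪ A
  lam_eq : ∃ τ, 0 < τ ∧ τ ≤ 1 ∧ (A = ∅ ∨ τ < 1) ∧ s'.lam = lift (maxOneNorm Q) τ s.lam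

theorem companion_cases {A : Finset (Fin (N + 1 + 4))} (hA : IsCompanion A)
    {j : Fin (N + 1 + 4)} (hj : j ∈ A) : A ≠ ∅ ∧ (j = newIdx N 2 ∨ j = newIdx N 3) := by
  rcases hA with rfl | rfl
  · simp at hj
  · exact ⟨by simp, by simpa using hj⟩

theorem lift_companion_pos {A : Finset (Fin (N + 1 + 4))} (hA : IsCompanion A) {M τ : ℝ}
    (hM : 0 < M) (α : Fin (N + 1) → ℝ) {j : Fin (N + 1 + 4)} (hj : j ∈ A) :
    (τ ≤ 1 → 0 ≤ lift M τ α j) ∧ (0 < lift M τ α j ↔ τ < 1) := by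
  have hp : ∀ c : ℝ, 0 < c → (τ ≤ 1 → 0 ≤ (1 - τ) * c) ∧ (0 < (1 - τ) * c ↔ τ < 1) := by
    intro c hc
    refine ⟨fun h => mul_nonneg (by linarith) hc.le, ?_⟩
    rw [mul_pos_iff_of_pos_right hc, sub_pos]
  rcases (companion_cases hA hj).2 with rfl | rfl
  · rw [lift_two]; exact hp _ (by positivity)
  · rw [lift_three]; exact hp _ (by positivity)

/-- The change of parameter is an increasing bijection of [0, 1] that preserves the signs of the old
coefficients. The companions impose no constraint, their coefficients being non-negative at both
ends. -/
theorem theta_transfer {C : Finset (Fin (N + 1))} {A : Finset (Fin (N + 1 + 4))}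
    (hA : IsCompanion A) {α lam : Fin (N + 1) → ℝ} {M τ₁ τ₂ θ : ℝ} (hM : 0 < M) (h1 : 0 < τ₁)
    (h1' : τ₁ ≤ 1) (h2 : 0 < τ₂) (h2' : τ₂ ≤ 1)
    (hθ : IsGreatest {τ : ℝ | τ ∈ Set.Icc 0 1 ∧ ∀ j ∈ C.map (oldEmb N) ∪ A,
      0 ≤ τ * lift M τ₁ α j + (1 - τ) * lift M τ₂ lam j} θ) :
    IsGreatest {τ : ℝ | τ ∈ Set.Icc 0 1 ∧ ∀ j ∈ C, 0 ≤ τ * α j + (1 - τ) * lam j}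
      (θ * τ₁ / (θ * τ₁ + (1 - θ) * τ₂)) := by
  have hpos : ∀ η : ℝ, 0 ≤ η → η ≤ 1 → ∀ a b : ℝ, 0 < a → 0 < b →
      0 < η * a + (1 - η) * b := by
    intro η h0 h1 a b ha hb
    rcases eq_or_lt_of_le h0 with h | h
    · rw [← h]; linarith
    · have := mul_pos h ha
      have := mul_nonneg (sub_nonneg.2 h1) hb.le
      linarith
  obtain ⟨⟨⟨h0, h1θ⟩, hall⟩, hmax⟩ := hθ
  have hσ := hpos θ h0 h1θ τ₁ τ₂ h1 h2
  refine ⟨⟨⟨div_nonneg (mul_nonneg h0 h1.le) hσ.le, ?_⟩, fun j hj => ?_⟩, ?_⟩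
  · rw [div_le_one hσ]
    have := mul_nonneg (sub_nonneg.2 h1θ) h2.le
    linarith
  · have h := hall (oldEmb N j) (Finset.mem_union_left _ (Finset.mem_map_of_mem _ hj))
    have e := congrFun (lift_mix (M := M) α lam hσ.ne') (oldEmb N j)
    rw [e, lift_old] at h
    exact nonneg_of_mul_nonneg_right h hσ
  · rintro η ⟨⟨hη0, hη1⟩, hη⟩
    have hρ := hpos η hη0 hη1 τ₂ τ₁ h2 h1
    -- The parameter inserted here is the preimage of η under the change of parameter.
    have hle := hmax (show η * τ₂ / (η * τ₂ + (1 - η) * τ₁) ∈ _ from ?_)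
    · rw [div_le_iff₀ hρ] at hle
      rw [le_div_iff₀ hσ]
      linarith
    · have hd0 : 0 ≤ η * τ₂ / (η * τ₂ + (1 - η) * τ₁) := div_nonneg (mul_nonneg hη0 h2.le) hρ.le
      have hd1 : η * τ₂ / (η * τ₂ + (1 - η) * τ₁) ≤ 1 := by
        rw [div_le_one hρ]
        have := mul_nonneg (sub_nonneg.2 hη1) h1.le
        linarith
      refine ⟨⟨hd0, hd1⟩, fun j hj => ?_⟩
      rcases Finset.mem_union.1 hj with hj | hj
      · obtain ⟨i, hi, rfl⟩ := Finset.mem_map.1 hj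
        rw [lift_old, lift_old]
        have e : η * τ₂ / (η * τ₂ + (1 - η) * τ₁) * (τ₁ * α i) +
            (1 - η * τ₂ / (η * τ₂ + (1 - η) * τ₁)) * (τ₂ * lam i) =
            τ₁ * τ₂ / (η * τ₂ + (1 - η) * τ₁) * (η * α i + (1 - η) * lam i) := by
          field_simp
          ring
        rw [e]
        exact mul_nonneg (by positivity) (hη i hi)
      · exact add_nonneg (mul_nonneg hd0 ((lift_companion_pos hA hM α hj).1 h1'))
          (mul_nonneg (sub_nonneg.2 hd1) ((lift_companion_pos hA hM lam hj).1 h2'))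

theorem MinorStep.of_lifted (hQ : Good Q) {A : Finset (Fin (N + 1 + 4))} (hA : IsCompanion A)
    {s : State (Fin (N + 1))} {s' t' : State (Fin (N + 1 + 4))} (hs : IsConvexState s)
    (hL : Lifted Q A s s') (h : MinorStep (extend Q) s' t') :
    ∃ t, MinorStep Q s t ∧ Lifted Q A t t' := by
  have hM := hQ.bounds.2.2.2.2.1
  obtain ⟨β, θ, i, hβ, hneg, hθ, hi, hz, hC, hl⟩ := h
  obtain ⟨hsC, τ₂, h2, h2', hA2, hlam⟩ := hL
  rw [hsC] at hβ hneg hθ hi hC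
  rw [hlam] at hθ hz hl
  obtain ⟨τ₁, α, h1, h1', rfl, hα, hA1⟩ := exists_lift hQ hA hs.nonempty hβ
  have hθ' := theta_transfer hA hM h1 h1' h2 h2' hθ
  obtain ⟨⟨⟨h0, hθ1⟩, hall⟩, -⟩ := hθ
  have hσ : 0 < θ * τ₁ + (1 - θ) * τ₂ := by
    rcases eq_or_lt_of_le h0 with h | h
    · rw [← h]; linarith
    · have := mul_pos h h1
      have := mul_nonneg (sub_nonneg.2 hθ1) h2.le
      linarith
  have hmix := lift_mix (M := maxOneNorm Q) α s.lam hσ.ne'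
  rw [hmix] at hl
  have hz' := (congrFun hmix i).symm.trans hz
  have hσ1 : θ * τ₁ + (1 - θ) * τ₂ ≤ 1 := by
    have := mul_nonneg h0 (sub_nonneg.2 h1')
    have := mul_nonneg (sub_nonneg.2 hθ1) (sub_nonneg.2 h2')
    linarith
  -- The scale of the new state reaches 1 only if θ = τ₁ = 1. Then the convex combination of points
  -- of `Q` with weights α would be 0, which is not in their hull. So r and s keep positive weight
  -- and the removed point is old.
  have hσA : A = ∅ ∨ θ * τ₁ + (1 - θ) * τ₂ < 1 := by
    rcases hA2 with hA2 | hA2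
    · exact Or.inl hA2
    rcases hA1 with hA1 | hA1
    · exact Or.inl hA1
    right
    rcases eq_or_lt_of_le hθ1 with hθ1 | hθ1
    · subst hθ1
      refine lt_of_le_of_ne hσ1 fun h => ?_
      refine hQ.comb_ne_zero (fun j hj => ?_) hα.sum_eq_one (hA1 (by linarith))
      have := hall (oldEmb N j) (Finset.mem_union_left _ (Finset.mem_map_of_mem _ hj))
      rw [lift_old, one_mul, sub_self, zero_mul, add_zero] at this
      exact nonneg_of_mul_nonneg_right this h1
    · have := mul_nonneg h0 (sub_nonneg.2 h1')
      have := mul_pos (sub_pos.2 hθ1) (sub_pos.2 hA2)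
      linarith
  have hiA : i ∉ A := by
    intro hiA
    exact ((lift_companion_pos hA hM _ hiA).2.2
      (hσA.resolve_left (companion_cases hA hiA).1)).ne' hz'
  obtain ⟨j, hj, rfl⟩ := Finset.mem_map.1 ((Finset.mem_union.1 hi).resolve_right hiA)
  rw [lift_old] at hz'
  refine ⟨⟨s.C.erase j, _⟩, ⟨α, _, j, hα, ?_, hθ', hj, (mul_eq_zero.1 hz').resolve_left hσ.ne',
    rfl, rfl⟩, ⟨?_, _, hσ, hσ1, hσA, hl⟩⟩
  -- A non-positive weight at r or s would mean τ₁ = 1, hence again 0 in the hull of `Q`; so a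
  -- non-positive weight occurs among the old points.
  · by_contra hno
    push Not at hno
    obtain ⟨k, hk, hk0⟩ := hneg
    rcases Finset.mem_union.1 hk with hk | hk
    · obtain ⟨l, hl, rfl⟩ := Finset.mem_map.1 hk
      rw [lift_old] at hk0
      exact absurd (mul_pos h1 (hno l hl)) (not_lt.2 hk0)
    · have h3 : τ₁ = 1 := by
        by_contra h3
        exact absurd ((lift_companion_pos hA hM α hk).2.2 (lt_of_le_of_ne h1' h3))
          (not_lt.2 hk0)
      exact hQ.comb_ne_zero (fun l hl => (hno l hl).le) hα.sum_eq_one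
        (hA1.resolve_left (companion_cases hA hk).1 h3)
  · rw [hC, Finset.erase_union_distrib, Finset.erase_eq_of_notMem (hA.oldEmb_notMem j),
      Finset.map_erase]

theorem minorSteps_of_lifted (hQ : Good Q) {A : Finset (Fin (N + 1 + 4))} (hA : IsCompanion A)
    {s : State (Fin (N + 1))} {s' t' : State (Fin (N + 1 + 4))} (hs : IsConvexState s)
    (hL : Lifted Q A s s') (h : Relation.ReflTransGen (MinorStep (extend Q)) s' t') :
    ∃ t, Relation.ReflTransGen (MinorStep Q) s t ∧ Lifted Q A t t' ∧ IsConvexState t := by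
  induction h with
  | refl => exact ⟨s, Relation.ReflTransGen.refl, hL, hs⟩
  | tail _ h ih =>
    obtain ⟨t, ht, hLt, hct⟩ := ih
    obtain ⟨w, hw, hLw⟩ := h.of_lifted hQ hA hct hLt
    exact ⟨w, ht.tail hw, hLw, hw.isConvexState hct⟩

/-- The points of lifted states, and what they say about the norm and the old points. -/
theorem Lifted.x_eq {A : Finset (Fin (N + 1 + 4))}
    {s : State (Fin (N + 1))} {s' : State (Fin (N + 1 + 4))} (hL : Lifted Q A s s')
    (hs : Settled Q s) (hs' : Settled (extend Q) s') :
    ∃ τ b c, 0 < τ ∧ s'.x (extend Q) = pad (τ • s.x Q) b c ∧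
      ‖s'.x (extend Q)‖ ^ 2 = τ * ‖s.x Q‖ ^ 2 := by
  obtain ⟨hsC, τ, h2, -, -, hlam⟩ := hL
  have hcomb := comb_extend Q hs'.coeffs.eq_zero
  rw [hlam] at hcomb
  simp only [lift_old, lift_zero, lift_one, add_zero, zero_div, zero_smul, mul_smul,
    ← Finset.smul_sum] at hcomb
  rw [← comb_eq_sum hs.coeffs.eq_zero, ← hlam] at hcomb
  refine ⟨τ, _, _, h2, hcomb, ?_⟩
  obtain ⟨i, hi⟩ := hs.nonempty
  rw [← hs'.inner_eq (oldEmb N i)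
    (by rw [hsC]; exact Finset.mem_union_left _ (Finset.mem_map_of_mem _ hi)), extend_old]
  refine (congrArg (fun z => inner ℝ z (pad (Q i) 0 0)) hcomb).trans ?_
  rw [inner_pad, inner_smul_left, mul_zero, mul_zero, add_zero, add_zero]
  simp only [conj_trivial]
  rw [← hs.inner_eq i hi, State.x]

/-- Passing to the lifted state multiplies both sides of the improvement inequality for an old point
by τ > 0. -/
theorem Lifted.improving_iff {A : Finset (Fin (N + 1 + 4))}
    {s : State (Fin (N + 1))} {s' : State (Fin (N + 1 + 4))} (hL : Lifted Q A s s')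
    (hs : Settled Q s) (hs' : Settled (extend Q) s') (j : Fin (N + 1)) :
    Improving (extend Q) (s'.x (extend Q)) (oldEmb N j) ↔ Improving Q (s.x Q) j := by
  obtain ⟨τ, b, c, hτ, hx, hn⟩ := hL.x_eq hs hs'
  rw [improving_old hx, hn, inner_smul_left, Improving]
  simp only [conj_trivial]
  exact mul_lt_mul_iff_right₀ hτ

theorem norm_extend_old (Q : Fin (N + 1) → EuclideanSpace ℝ (Fin (D + 1))) (i : Fin (N + 1)) :
    ‖extend Q (oldEmb N i)‖ = ‖Q i‖ := by
  rw [← sq_eq_sq₀ (norm_nonneg _) (norm_nonneg _), extend_old, norm_sq_pad]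
  ring

/-- An index that is at least as good as an old one is old. -/
theorem Good.eq_oldEmb (hQ : Good Q) {i : Fin (N + 1)} {j : Fin (N + 1 + 4)}
    (h : ‖extend Q j‖ ≤ ‖extend Q (oldEmb N i)‖) : ∃ l, j = oldEmb N l := by
  obtain ⟨n0, n1, n2, n3⟩ := hQ.norm_lt
  have := n0 i
  rcases idx_cases j with hj | rfl | rfl | rfl | rfl
  · exact hj
  all_goals linarith

theorem Lifted.not_terminal {A : Finset (Fin (N + 1 + 4))}
    {s : State (Fin (N + 1))} {s' : State (Fin (N + 1 + 4))} (hL : Lifted Q A s s')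
    (hs : Settled Q s) (hs' : Settled (extend Q) s') (hT : ¬ Terminal Q s) :
    ¬ Terminal (extend Q) s' := by
  unfold Terminal at hT
  push Not at hT
  obtain ⟨hx, j, hj⟩ := hT
  rintro (h0 | h0)
  · obtain ⟨τ, b, c, hτ, -, hn⟩ := hL.x_eq hs hs'
    rw [h0, norm_zero] at hn
    have : 0 < ‖s.x Q‖ := norm_pos_iff.2 hx
    have : 0 < τ * ‖s.x Q‖ ^ 2 := by positivity
    linarith
  · exact h0 _ ((hL.improving_iff hs hs' j).2 hj)

/-- Below the optimum some old point improves, and all new points are longer, so the rule picks an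
old point, by the same comparison of norms as in `Q`. -/
theorem MajorStep.of_lifted (hQ : Good Q) {A : Finset (Fin (N + 1 + 4))} (hA : IsCompanion A)
    {s : State (Fin (N + 1))} {s' t' : State (Fin (N + 1 + 4))} (hs : Settled Q s)
    (hs' : Settled (extend Q) s') (hT : ¬ Terminal Q s)
    (hL : Lifted Q A s s') (h : MajorStep (extend Q) s' t') :
    ∃ t, MajorStep Q s t ∧ Lifted Q A t t' := by
  have hM := hQ.bounds.2.2.2.2.1
  unfold Terminal at hT
  push Not at hT
  obtain ⟨hx, l, hl⟩ := hT
  obtain ⟨-, j', ⟨hj, hjmin⟩, u', hu', htC, hβ, hpos⟩ := h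
  have himp := hL.improving_iff hs hs'
  obtain ⟨j, rfl⟩ := hQ.eq_oldEmb (hjmin _ ((himp l).2 hl))
  have hj' := (himp j).1 hj
  have hL' : Lifted Q A ⟨insert j s.C, s.lam⟩ ⟨insert (oldEmb N j) s'.C, s'.lam⟩ := by
    refine ⟨?_, hL.lam_eq⟩
    change insert (oldEmb N j) s'.C = (insert j s.C).map (oldEmb N) ∪ A
    rw [hL.C_eq, Finset.map_insert, Finset.insert_union]
  obtain ⟨u, hu, hLu, hcu⟩ := minorSteps_of_lifted hQ hA
    (IsConvexState.insert hs fun h => hs.not_improving h hj') hL' hu'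
  rw [hLu.C_eq] at hβ hpos htC
  obtain ⟨τ, α, h1, h1', hlam, hα, hA1⟩ := exists_lift hQ hA hcu.nonempty hβ
  refine ⟨⟨u.C, α⟩, ⟨hx, j, ⟨hj', fun k hk => ?_⟩, u, hu, rfl, hα, fun i hi => ?_⟩,
    ⟨htC, τ, h1, h1', ?_, hlam⟩⟩
  · have := hjmin _ ((himp k).2 hk)
    rwa [norm_extend_old, norm_extend_old] at this
  · have := hpos (oldEmb N i) (Finset.mem_union_left _ (Finset.mem_map_of_mem _ hi))
    rw [hlam, lift_old] at this
    exact (mul_pos_iff_of_pos_left h1).1 this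
  · rcases A.eq_empty_or_nonempty with h0 | ⟨k, hk⟩
    · exact Or.inl h0
    · have := hpos k (Finset.mem_union_right _ hk)
      rw [hlam] at this
      exact Or.inr ((lift_companion_pos hA hM α hk).2.1 this)

theorem Forced.ne_nil {ι E : Type*} [DecidableEq ι] [NormedAddCommGroup E]
    [InnerProductSpace ℝ E] {p : ι → E} {s : State ι} {L : List (Finset ι)} (h : Forced p s L) :
    L ≠ [] := by
  cases h <;> simp

/-- An execution on the smaller family determines one on the extended family, up to the optimum of
the smaller family. -/
theorem Forced.lift (hQ : Good Q) {A : Finset (Fin (N + 1 + 4))} (hA : IsCompanion A)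
    {s : State (Fin (N + 1))} {L : List (Finset (Fin (N + 1)))} (hF : Forced Q s L)
    (hs : Settled Q s) {O : Finset (Fin (N + 1))} {K : List (Finset (Fin (N + 1 + 4)))}
    (hO : L.getLast? = some O)
    (hend : ∀ u u', Settled Q u → Settled (extend Q) u' → Terminal Q u → u.C = O →
      Lifted Q A u u' → Forced (extend Q) u' (u'.C :: K))
    {s' : State (Fin (N + 1 + 4))} (hs' : Settled (extend Q) s') (hL : Lifted Q A s s') :
    Forced (extend Q) s' (L.map (fun S => S.map (oldEmb N) ∪ A) ++ K) := by
  induction hF generalizing s' with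
  | halt s hT =>
    have := hend s s' hs hs' hT (by simpa using hO) hL
    rw [hL.C_eq] at this
    simpa using this
  | step s L hT hM ih =>
    rw [List.map_cons, List.cons_append, ← hL.C_eq]
    refine Forced.step _ _ (hL.not_terminal hs hs' hT) fun t' ht' => ?_
    obtain ⟨t, ht, hLt⟩ := ht'.of_lifted hQ hA hs hs' hT hL
    refine ih t ht (ht.settled hs) ?_ (ht'.settled hs') hLt
    rwa [List.getLast?_cons_of_ne_nil (hM t ht).ne_nil] at hO

end Lift

/-! ### The forced run on the extended family, stage by stage -/

section Execution

variable {N D : ℕ} {Q : Fin (N + 1) → EuclideanSpace ℝ (Fin (D + 1))}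

theorem not_terminal_of_improving {ι E : Type*} [NormedAddCommGroup E]
    [InnerProductSpace ℝ E] {p : ι → E} {s : State ι} {j : ι} (h : Improving p (s.x p) j) :
    ¬ Terminal p s := by
  rintro (h0 | h0)
  · rw [Improving, h0, inner_zero_left, norm_zero] at h
    simp at h
  · exact h0 j h

theorem Settled.x_ne_zero (hQ : Good Q) {s : State (Fin (N + 1))} (hs : Settled Q s) :
    s.x Q ≠ 0 :=
  hQ.comb_ne_zero (fun i hi => (hs.pos i hi).le) hs.coeffs.sum_eq_one

theorem Settled.x_mem {ι E : Type*} [NormedAddCommGroup E] [InnerProductSpace ℝ E] {p : ι → E}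
    {s : State ι} (hs : Settled p s) : s.x p ∈ convexHull ℝ (Set.range p) :=
  comb_mem_convexHull (fun i hi => (hs.pos i hi).le) hs.coeffs.sum_eq_one

theorem Settled.x_eq_minNormPoint (hQ : Good Q) {s : State (Fin (N + 1))} (hs : Settled Q s)
    (hT : Terminal Q s) : s.x Q = minNormPoint Q := by
  refine eq_minNormPoint hs.x_mem fun i => ?_
  exact not_lt.1 (hT.resolve_left (hs.x_ne_zero hQ) i)

/-- Having r and s in the corral forces the last coordinate to be 0 and the squared norm to be bm/4.
For p and q a non-negative multiple of X is added to this, so they do not improve. -/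
theorem Lifted.terminal (hQ : Good Q) {u : State (Fin (N + 1))} {u' : State (Fin (N + 1 + 4))}
    (hu : Settled Q u) (hu' : Settled (extend Q) u') (hT : Terminal Q u)
    (hL : Lifted Q {newIdx N 2, newIdx N 3} u u') : Terminal (extend Q) u' := by
  obtain ⟨hX, hX1, hm, hmX, hM, hXM⟩ := hQ.bounds
  obtain ⟨τ, b, c, hτ, hx, hn⟩ := hL.x_eq hu hu'
  have hmem2 : newIdx N 2 ∈ u'.C := by rw [hL.C_eq]; simp
  have hmem3 : newIdx N 3 ∈ u'.C := by rw [hL.C_eq]; simp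
  obtain ⟨-, -, -, e2, e3⟩ := extend_coeffs hu'.coeffs hx
  have e2' := e2 hmem2
  have e3' := e3 hmem3
  have hc : c = 0 := by
    have : c * (2 * maxOneNorm Q + 5) = 0 := by linarith only [e2', e3']
    exact (mul_eq_zero.1 this).resolve_right (by linarith)
  obtain ⟨i0, i1, -, -⟩ := improving_new (Q := Q) hx
  have hge : 0 ≤ inner ℝ (τ • u.x Q) (minNormPoint Q) := by
    rw [inner_smul_left, hu.x_eq_minNormPoint hQ hT, real_inner_self_eq_norm_sq]
    simp only [conj_trivial]
    positivity
  have hk : ‖u'.x (extend Q)‖ ^ 2 = b * (supNorm (minNormPoint Q) / 4) := by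
    rw [hx, norm_sq_pad, ← e2', hc]
    ring
  right
  intro j
  rcases idx_cases j with ⟨i, rfl⟩ | rfl | rfl | rfl | rfl
  · rw [hL.improving_iff hu hu']
    exact hT.resolve_left (hu.x_ne_zero hQ) i
  · rw [i0, hk, hc]; linarith
  · rw [i1, hk, hc]; linarith
  · exact hu'.not_improving hmem2
  · exact hu'.not_improving hmem3

/-- The current point (0, m/4, 0) is orthogonal to every old point, so all of them improve and a
shortest one enters: the smaller run starts afresh, now with r and s as companions. -/
theorem forced_two_three (hQ : Good Q) {L : List (Finset (Fin (N + 1)))}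
    (hL : ∀ i, (∀ j, ‖Q i‖ ≤ ‖Q j‖) → Forced Q ⟨{i}, Pi.single i 1⟩ L)
    {s : State (Fin (N + 1 + 4))} (hs : Settled (extend Q) s)
    (hC : s.C = {newIdx N 2, newIdx N 3}) :
    Forced (extend Q) s ({newIdx N 2, newIdx N 3} ::
      L.map (fun S => S.map (oldEmb N) ∪ {newIdx N 2, newIdx N 3})) := by
  obtain ⟨hX, hX1, hm, hmX, hM, hXM⟩ := hQ.bounds
  have hα := hs.coeffs
  rw [hC] at hα
  have hx := (coeffs_two_three hQ (Finset.empty_subset _) (A := ∅)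
    (by rwa [Finset.empty_union])).2.2.2
  rw [Finset.empty_union, ← hC] at hx
  change s.x (extend Q) = _ at hx
  have hk : ‖s.x (extend Q)‖ ^ 2 = (supNorm (minNormPoint Q) / 4) ^ 2 := by
    rw [hx, norm_sq_pad, norm_zero]; ring
  have hold : ∀ i, Improving (extend Q) (s.x (extend Q)) (oldEmb N i) := by
    intro i
    rw [improving_old hx, hk, inner_zero_left]
    positivity
  suffices hF : Forced (extend Q) s (s.C ::
      L.map (fun S => S.map (oldEmb N) ∪ {newIdx N 2, newIdx N 3})) by rwa [hC] at hF
  refine Forced.step _ _ (not_terminal_of_improving (hold 0)) fun t ht => ?_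
  have hts := ht.settled hs
  obtain ⟨l, hl, htC⟩ := ht.exists_eq_of_eliminate hs (A := ∅)
    (B := fun l => insert l {newIdx N 2, newIdx N 3}) (Finset.empty_subset _) (by
      intro l hl
      obtain ⟨i, rfl⟩ := hQ.eq_oldEmb (hl.2 _ (hold 0))
      refine ⟨by rw [hC, Finset.empty_union], fun A' hA' α hα => ?_⟩
      rw [Finset.subset_empty.1 hA', Finset.empty_union] at hα
      refine ⟨?_, fun h => absurd (Finset.subset_empty.1 hA') h.ne_empty⟩
      have e : insert (oldEmb N i) ({newIdx N 2, newIdx N 3} : Finset (Fin (N + 1 + 4))) =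
          ({i} : Finset (Fin (N + 1))).map (oldEmb N) ∪ {newIdx N 2, newIdx N 3} := by
        rw [Finset.map_singleton, Finset.insert_eq]
      rw [e] at hα ⊢
      obtain ⟨τ, β, h1, h1', rfl, hβ, hA⟩ :=
        exists_lift hQ (Or.inr rfl) (Finset.singleton_nonempty i) hα
      have hβi : β i = 1 := by simpa using hβ.sum_eq_one
      have hτ : τ < 1 := by
        refine lt_of_le_of_ne h1' fun hτ => ?_
        refine hQ.comb_ne_zero (C := {i}) (α := β) (fun j hj => ?_) hβ.sum_eq_one
          (hA.resolve_left (by simp) hτ)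
        rw [Finset.mem_singleton] at hj
        rw [hj, hβi]
        exact zero_le_one
      intro j hj
      rcases Finset.mem_union.1 hj with hj | hj
      · rw [Finset.map_singleton, Finset.mem_singleton] at hj
        rw [hj, lift_old, hβi, mul_one]
        exact h1
      · exact (lift_companion_pos (Or.inr rfl) hM β hj).2.2 hτ)
  obtain ⟨i, rfl⟩ := hQ.eq_oldEmb (hl.2 _ (hold 0))
  have hmin : ∀ j, ‖Q i‖ ≤ ‖Q j‖ := by
    intro j
    have := hl.2 _ (hold j)
    rwa [norm_extend_old, norm_extend_old] at this
  have htC' : t.C = ({i} : Finset (Fin (N + 1))).map (oldEmb N) ∪ {newIdx N 2, newIdx N 3} := by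
    rw [htC, Finset.map_singleton, Finset.insert_eq]
  have hβ := hts.coeffs
  rw [htC'] at hβ
  obtain ⟨τ, β, h1, h1', hlam, hβ', -⟩ :=
    exists_lift hQ (Or.inr rfl) (Finset.singleton_nonempty i) hβ
  have hβi : β = Pi.single i 1 := by
    funext j
    by_cases hj : j = i
    · subst hj
      simpa using hβ'.sum_eq_one
    · rw [Pi.single_eq_of_ne hj]
      exact hβ'.eq_zero j (by simpa using hj)
  have hτ : τ < 1 := by
    have h2 := hts.pos (newIdx N 2) (by rw [htC']; simp)
    rw [hlam] at h2
    exact (lift_companion_pos (A := {newIdx N 2, newIdx N 3}) (Or.inr rfl) hM β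
      (by simp)).2.1 h2
  have hF := hL i hmin
  obtain ⟨O, hO⟩ : ∃ O, L.getLast? = some O :=
    ⟨_, List.getLast?_eq_some_getLast hF.ne_nil⟩
  have := hF.lift hQ (A := {newIdx N 2, newIdx N 3}) (Or.inr rfl) (settled_singleton Q i) hO
    (K := []) (fun u u' hu hu' hT _ hLu => Forced.halt u' (hLu.terminal hQ hu hu' hT)) hts
    ⟨htC', τ, h1, h1', Or.inr hτ, by rw [hlam, hβi]⟩
  rwa [List.append_nil] at this

/-- The last coordinate h is positive. Compared with r, the inner product at s is smaller by h(2M +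
5); compared with q, that at p is larger by h(2M + 1). Old points do not improve by the norm bound
in `coeffs_one_two`. -/
theorem forced_one_two (hQ : Good Q) {K : List (Finset (Fin (N + 1 + 4)))}
    (hK : ∀ t, Settled (extend Q) t → t.C = {newIdx N 2, newIdx N 3} → Forced (extend Q) t K)
    {s : State (Fin (N + 1 + 4))} (hs : Settled (extend Q) s)
    (hC : s.C = {newIdx N 1, newIdx N 2}) :
    Forced (extend Q) s ({newIdx N 1, newIdx N 2} :: K) := by
  obtain ⟨hX, hX1, hm, hmX, hM, hXM⟩ := hQ.bounds
  have hα := hs.coeffs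
  rw [hC] at hα
  obtain ⟨v, h, hv, hh, hx, hk⟩ := (coeffs_one_two hQ (Finset.empty_subset _) (A := ∅)
    (by rwa [Finset.empty_union])).2.2.2 rfl
  rw [Finset.empty_union, ← hC] at hx hk
  change s.x (extend Q) = _ at hx
  change ‖s.x (extend Q)‖ ^ 2 ≤ _ at hk
  have hm1 : newIdx N 1 ∈ s.C := by rw [hC]; simp
  have hm2 : newIdx N 2 ∈ s.C := by rw [hC]; simp
  obtain ⟨-, -, e1, e2, -⟩ := extend_coeffs hs.coeffs hx
  have e1' := e1 hm1
  have e2' := e2 hm2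
  rw [← norm_sq_pad, ← hx] at e1' e2'
  obtain ⟨i0, -, -, i3⟩ := improving_new (Q := Q) hx
  have hM5 := mul_pos hh (show 0 < 2 * maxOneNorm Q + 5 by linarith)
  have hM1 := mul_pos hh (show 0 < 2 * maxOneNorm Q + 1 by linarith)
  have himp : Improving (extend Q) (s.x (extend Q)) (newIdx N 3) := by
    rw [i3, ← e2']; linarith
  rw [← hC]
  refine Forced.step _ _ (not_terminal_of_improving himp) fun t ht => hK t (ht.settled hs) ?_
  refine ht.eq_of_eliminate hs (A := {newIdx N 1}) (j := newIdx N 3) ?_ (fun l hl => ?_) ?_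
    fun A' hA' α hα => ?_
  · rw [Finset.singleton_subset_iff]; exact hm1
  · rcases idx_cases l with ⟨i, rfl⟩ | rfl | rfl | rfl | rfl
    · have := hl.1
      rw [improving_old hx, inner_smul_left] at this
      simp only [conj_trivial] at this
      have := mul_le_mul_of_nonneg_left (minNormPoint_inner Q i) (half_pos hv).le
      linarith
    · have := hl.1
      rw [i0, ← e1'] at this
      linarith
    · exact absurd hl.1 (hs.not_improving hm1)
    · exact absurd hl.1 (hs.not_improving hm2)
    · rfl
  · rw [hC]
    ext; simp; tauto
  · obtain ⟨h2, h3, h1, -⟩ := coeffs_two_three hQ hA' hα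
    refine ⟨fun i hi => ?_, fun ⟨i, hi⟩ => ⟨i, hi, ?_⟩⟩
    · rcases Finset.mem_insert.1 hi with rfl | hi
      · exact h2
      · rw [Finset.mem_singleton.1 hi]; exact h3
    · rw [Finset.mem_singleton.1 (hA' hi), h1]

/-- The current point is (x*/2, m/4, 0), of squared norm X/4 + m²/16. The inner product at r is
m²/16, so r improves; at old points it is at least X/2, which is enough as m² ≤ X; s is longer than
r. -/
theorem forced_zero_one (hQ : Good Q) {K : List (Finset (Fin (N + 1 + 4)))}
    (hK : ∀ t, Settled (extend Q) t → t.C = {newIdx N 1, newIdx N 2} → Forced (extend Q) t K)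
    {s : State (Fin (N + 1 + 4))} (hs : Settled (extend Q) s)
    (hC : s.C = {newIdx N 0, newIdx N 1}) :
    Forced (extend Q) s ({newIdx N 0, newIdx N 1} :: K) := by
  obtain ⟨hX, hX1, hm, hmX, hM, hXM⟩ := hQ.bounds
  have hα := hs.coeffs
  rw [hC] at hα
  obtain ⟨-, -, -, hbal⟩ := coeffs_zero_one hQ (A := ∅) (by simp)
    (by rwa [Finset.map_empty, Finset.empty_union])
  have hold : ∀ i, s.lam (oldEmb N i) = 0 := fun i => hα.eq_zero _ (by
    simp [oldEmb_ne_newIdx])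
  have h2 : s.lam (newIdx N 2) = 0 := hα.eq_zero _ (by simp [newIdx_eq_iff])
  have h3 : s.lam (newIdx N 3) = 0 := hα.eq_zero _ (by simp [newIdx_eq_iff])
  have hsum := hα.sum_eq_one
  rw [sum_extend hα.eq_zero] at hsum
  have hcomb := comb_extend Q hα.eq_zero
  simp only [hold, h2, h3, zero_smul, Finset.sum_const_zero, zero_add, add_zero, zero_mul,
    sub_zero] at hsum hcomb
  rw [hsum, hbal, sub_self, one_mul, ← hC] at hcomb
  have hx : s.x (extend Q) = _ := hcomb
  have hm0 : newIdx N 0 ∈ s.C := by rw [hC]; simp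
  have hm1 : newIdx N 1 ∈ s.C := by rw [hC]; simp
  have hk : ‖s.x (extend Q)‖ ^ 2 =
      ‖minNormPoint Q‖ ^ 2 / 4 + supNorm (minNormPoint Q) ^ 2 / 16 := by
    rw [hx, norm_sq_pad, norm_smul, mul_pow, Real.norm_eq_abs, sq_abs]
    ring
  obtain ⟨-, -, i2, -⟩ := improving_new (Q := Q) hx
  have himp : Improving (extend Q) (s.x (extend Q)) (newIdx N 2) := by
    rw [i2, hk]; linarith
  rw [← hC]
  refine Forced.step _ _ (not_terminal_of_improving himp) fun t ht => hK t (ht.settled hs) ?_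
  refine ht.eq_of_eliminate hs (A := {newIdx N 0}) (j := newIdx N 2) ?_ (fun l hl => ?_) ?_
    fun A' hA' α hα => ?_
  · rw [Finset.singleton_subset_iff]; exact hm0
  · rcases idx_cases l with ⟨i, rfl⟩ | rfl | rfl | rfl | rfl
    · have := hl.1
      rw [improving_old hx, inner_smul_left, hk] at this
      simp only [conj_trivial] at this
      have := minNormPoint_inner Q i
      linarith
    · exact absurd hl.1 (hs.not_improving hm0)
    · exact absurd hl.1 (hs.not_improving hm1)
    · rfl
    · exact absurd (hl.2 _ himp) (not_le.2 hQ.norm_lt.2.2.2)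
  · rw [hC]
    ext; simp; tauto
  · obtain ⟨h1, h2, h0, -⟩ := coeffs_one_two hQ hA' hα
    refine ⟨fun i hi => ?_, fun hne => ?_⟩
    · rcases Finset.mem_insert.1 hi with rfl | hi
      · exact h1
      · rw [Finset.mem_singleton.1 hi]; exact h2
    · obtain ⟨i, hi⟩ := hne
      refine ⟨i, hi, ?_⟩
      rw [Finset.mem_singleton.1 (hA' hi)]
      exact h0 ⟨i, hi⟩

/-- The old part of the current point is (1 - v/2)x* and the squared norm is (1 - v/2)X, so
optimality of x* keeps the old points from improving. At q the inner product is smaller than at p by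
vM(2M + 1). -/
theorem forced_zero (hQ : Good Q) {K : List (Finset (Fin (N + 1 + 4)))}
    (hK : ∀ t, Settled (extend Q) t → t.C = {newIdx N 0, newIdx N 1} → Forced (extend Q) t K)
    {u : State (Fin (N + 1))} (hu : Settled Q u) (hT : Terminal Q u)
    {s : State (Fin (N + 1 + 4))} (hs : Settled (extend Q) s)
    (hC : s.C = u.C.map (oldEmb N) ∪ {newIdx N 0}) :
    Forced (extend Q) s ((u.C.map (oldEmb N) ∪ {newIdx N 0}) :: K) := by
  obtain ⟨hX, hX1, hm, hmX, hM, hXM⟩ := hQ.bounds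
  have hux := hu.x_eq_minNormPoint hQ hT
  have hα := hs.coeffs
  rw [hC] at hα
  obtain ⟨ht0, ht1, -, hx⟩ := coeffs_zero hQ hu.indep hu.nonempty hu.coeffs hux hα
  rw [← hC] at hx
  change s.x (extend Q) = _ at hx
  set v := s.lam (newIdx N 0)
  have hm0 : newIdx N 0 ∈ s.C := by rw [hC]; simp
  have hO : ∀ i ∈ u.C, inner ℝ (minNormPoint Q) (Q i) = ‖minNormPoint Q‖ ^ 2 := by
    rw [← hux]; exact hu.inner_eq
  have hmo : ∀ i ∈ u.C, oldEmb N i ∈ s.C := fun i hi => by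
    rw [hC]; exact Finset.mem_union_left _ (Finset.mem_map_of_mem _ hi)
  obtain ⟨e, e0, -, -, -⟩ := extend_coeffs hs.coeffs hx
  have e0' := e0 hm0
  have hk : ‖s.x (extend Q)‖ ^ 2 = (1 - v / 2) * ‖minNormPoint Q‖ ^ 2 := by
    obtain ⟨i, hi⟩ := hu.nonempty
    rw [hx, norm_sq_pad, ← e i (hmo i hi), inner_smul_left, hO i hi]
    simp
  rw [← norm_sq_pad, ← hx] at e0'
  obtain ⟨-, i1, -, -⟩ := improving_new (Q := Q) hx
  have hvM := mul_pos (mul_pos ht0 hM) (show 0 < 2 * maxOneNorm Q + 1 by linarith)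
  have himp : Improving (extend Q) (s.x (extend Q)) (newIdx N 1) := by
    rw [i1, ← e0']; linarith
  rw [← hC]
  refine Forced.step _ _ (not_terminal_of_improving himp) fun t ht => hK t (ht.settled hs) ?_
  refine ht.eq_of_eliminate hs (A := u.C.map (oldEmb N)) (j := newIdx N 1) ?_ (fun l hl => ?_)
    ?_ fun A' hA' α hα => ?_
  · rw [hC]; exact Finset.subset_union_left
  · obtain ⟨-, -, n2, n3⟩ := hQ.norm_lt
    have hle := hl.2 _ himp
    rcases idx_cases l with ⟨i, rfl⟩ | rfl | rfl | rfl | rfl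
    · have := hl.1
      rw [improving_old hx, inner_smul_left, hk] at this
      simp only [conj_trivial] at this
      have := mul_le_mul_of_nonneg_left (minNormPoint_inner Q i)
        (show 0 ≤ 1 - v / 2 by linarith)
      linarith
    · exact absurd hl.1 (hs.not_improving hm0)
    · rfl
    · linarith
    · linarith
  · rw [hC]
    ext; simp; tauto
  · obtain ⟨A'', hA'', rfl⟩ := Finset.subset_map_iff.1 hA'
    obtain ⟨h0, h1, hneg, -⟩ := coeffs_zero_one hQ (fun i hi => hO i (hA'' hi)) hα
    refine ⟨fun i hi => ?_, fun hne => ?_⟩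
    · rcases Finset.mem_insert.1 hi with rfl | hi
      · exact h0
      · rw [Finset.mem_singleton.1 hi]; exact h1
    · obtain ⟨i, hi, hi0⟩ := hneg (Finset.map_nonempty.1 hne)
      exact ⟨_, Finset.mem_map_of_mem _ hi, hi0⟩

theorem forced_optimum (hQ : Good Q) {K : List (Finset (Fin (N + 1 + 4)))}
    {u : State (Fin (N + 1))} (hu : Settled Q u) (hT : Terminal Q u)
    (hK : ∀ t, Settled (extend Q) t → t.C = u.C.map (oldEmb N) ∪ {newIdx N 0} →
      Forced (extend Q) t K)
    {s : State (Fin (N + 1 + 4))} (hs : Settled (extend Q) s) (hL : Lifted Q ∅ u s) :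
    Forced (extend Q) s (s.C :: K) := by
  obtain ⟨hX, hX1, hm, hmX, hM, hXM⟩ := hQ.bounds
  have hux := hu.x_eq_minNormPoint hQ hT
  obtain ⟨hC, τ, hτ, -, -, hlam⟩ := hL
  have hnew : ∀ a, s.lam (newIdx N a) = 0 := fun a => hs.coeffs.eq_zero _ (by
    rw [hC, newIdx_mem_map_union]; simp)
  -- Without companions r has weight 0, while a lift of scale τ gives it a nonzero multiple of 1 -
  -- τ.
  have hτ1 : τ = 1 := by
    have h2 := hnew 2
    rw [hlam, lift_two] at h2
    have : (maxOneNorm Q + 3) / (2 * maxOneNorm Q + 5) ≠ 0 := by positivity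
    have := (mul_eq_zero.1 h2).resolve_right this
    linarith
  have hcomb := comb_extend Q hs.coeffs.eq_zero
  simp only [hnew, add_zero, zero_mul, zero_div, zero_smul, sub_zero, hlam, hτ1, lift_old,
    one_mul] at hcomb
  rw [← comb_eq_sum hu.coeffs.eq_zero, show comb Q u.C u.lam = _ from hux] at hcomb
  have hx : s.x (extend Q) = pad (minNormPoint Q) 0 0 := by
    rw [← hcomb, State.x, hlam, hτ1]
  have hk : ‖s.x (extend Q)‖ ^ 2 = ‖minNormPoint Q‖ ^ 2 := by
    rw [hx, norm_sq_pad]; ring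
  obtain ⟨i0, -, -, -⟩ := improving_new (Q := Q) hx
  have himp : Improving (extend Q) (s.x (extend Q)) (newIdx N 0) := by
    rw [i0, hk, real_inner_self_eq_norm_sq]; linarith
  refine Forced.step _ _ (not_terminal_of_improving himp) fun t ht => hK t (ht.settled hs) ?_
  refine ht.eq_of_eliminate hs (A := ∅) (j := newIdx N 0) (Finset.empty_subset _)
    (fun l hl => ?_) ?_ fun A' hA' α hα => ?_
  · obtain ⟨-, n1, n2, n3⟩ := hQ.norm_lt
    have hle := hl.2 _ himp
    rcases idx_cases l with ⟨i, rfl⟩ | rfl | rfl | rfl | rfl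
    · have := hl.1
      rw [improving_old hx, hk] at this
      exact absurd (minNormPoint_inner Q i) (not_le.2 this)
    · rfl
    all_goals linarith
  · rw [hC, Finset.empty_union, Finset.union_empty, Finset.insert_eq, Finset.union_comm]
  · rw [Finset.subset_empty.1 hA', Finset.empty_union] at hα
    refine ⟨fun i hi => ?_, fun h => absurd (Finset.subset_empty.1 hA') h.ne_empty⟩
    obtain ⟨h0, h1, hc, -⟩ := coeffs_zero hQ hu.indep hu.nonempty hu.coeffs hux hα
    rcases Finset.mem_union.1 hi with hi | hi
    · obtain ⟨k, hk, rfl⟩ := Finset.mem_map.1 hi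
      rw [hc k hk]
      exact mul_pos (by linarith) (hu.pos k hk)
    · rw [Finset.mem_singleton.1 hi]
      exact h0

/-- The recursion for the corral sequence. -/
def nextSequence {N : ℕ} (L : List (Finset (Fin (N + 1)))) : List (Finset (Fin (N + 1 + 4))) :=
  L.map (fun S => S.map (oldEmb N)) ++
    [(L.getLast?.getD ∅).map (oldEmb N) ∪ {newIdx N 0}, {newIdx N 0, newIdx N 1},
      {newIdx N 1, newIdx N 2}, {newIdx N 2, newIdx N 3}] ++
    L.map (fun S => S.map (oldEmb N) ∪ {newIdx N 2, newIdx N 3})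

theorem forced_extend (hQ : Good Q) {L : List (Finset (Fin (N + 1)))}
    (hL : ∀ i, (∀ j, ‖Q i‖ ≤ ‖Q j‖) → Forced Q ⟨{i}, Pi.single i 1⟩ L)
    (i : Fin (N + 1 + 4)) (hi : ∀ j, ‖extend Q i‖ ≤ ‖extend Q j‖) :
    Forced (extend Q) ⟨{i}, Pi.single i 1⟩ (nextSequence L) := by
  obtain ⟨i, rfl⟩ := hQ.eq_oldEmb (hi (oldEmb N 0))
  have hmin : ∀ j, ‖Q i‖ ≤ ‖Q j‖ := by
    intro j
    have := hi (oldEmb N j)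
    rwa [norm_extend_old, norm_extend_old] at this
  have hF := hL i hmin
  obtain ⟨O, hO⟩ : ∃ O, L.getLast? = some O :=
    ⟨_, List.getLast?_eq_some_getLast hF.ne_nil⟩
  have key := hF.lift hQ (A := ∅) (Or.inl rfl) (settled_singleton Q i) hO
    (K := (O.map (oldEmb N) ∪ {newIdx N 0}) :: {newIdx N 0, newIdx N 1} ::
      {newIdx N 1, newIdx N 2} :: {newIdx N 2, newIdx N 3} ::
      L.map (fun S => S.map (oldEmb N) ∪ {newIdx N 2, newIdx N 3})) ?_
    (settled_singleton (extend Q) (oldEmb N i)) ⟨by simp, 1, one_pos, le_rfl, Or.inl rfl, ?_⟩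
  · simpa [nextSequence, hO] using key
  · intro u u' hu hu' hT huO hLu
    subst huO
    refine forced_optimum hQ hu hT (fun t ht htC => ?_) hu' hLu
    refine forced_zero hQ (fun t ht htC => ?_) hu hT ht htC
    refine forced_zero_one hQ (fun t ht htC => ?_) ht htC
    refine forced_one_two hQ (fun t ht htC => ?_) ht htC
    exact forced_two_three hQ hL ht htC
  · refine eq_lift (fun j => ?_) ?_ ?_ ?_ ?_
    · change (Pi.single (oldEmb N i) (1 : ℝ) : Fin (N + 1 + 4) → ℝ) (oldEmb N j) =
        1 * (Pi.single i (1 : ℝ) : Fin (N + 1) → ℝ) j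
      by_cases hj : j = i
      · subst hj; simp
      · rw [Pi.single_eq_of_ne hj, Pi.single_eq_of_ne fun h => hj ((oldEmb N).injective h),
          mul_zero]
    all_goals simp [(oldEmb_ne_newIdx _ _).symm]

end Execution

/-! ### The minimum norm point of the extended family -/

section MinNormExtend

variable {N D : ℕ} {Q : Fin (N + 1) → EuclideanSpace ℝ (Fin (D + 1))}

theorem pad_mem_convexHull_extend {v : EuclideanSpace ℝ (Fin (D + 1))}
    (hv : v ∈ convexHull ℝ (Set.range Q)) : pad v 0 0 ∈ convexHull ℝ (Set.range (extend Q)) := by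
  have hc : Convex ℝ {v : EuclideanSpace ℝ (Fin (D + 1)) |
      pad v 0 0 ∈ convexHull ℝ (Set.range (extend Q))} := by
    intro v hv w hw a b ha hb hab
    have := convex_convexHull ℝ (Set.range (extend Q)) hv hw ha hb hab
    rw [smul_pad, smul_pad, pad_add_pad] at this
    simpa using this
  refine convexHull_min ?_ hc hv
  rintro _ ⟨i, rfl⟩
  exact subset_convexHull ℝ _ ⟨oldEmb N i, extend_old Q i⟩

/-- The hull contains (x*, 0, 0) and w = (0, m/4, 0), which are orthogonal. The claimed point is the
foot of the perpendicular from 0 to the segment between them; the optimality inequalities for `Q`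
pass to the old points, and at p and q there is a surplus τX/2. -/
theorem minNormPoint_extend (hQ : Good Q) :
    minNormPoint (extend Q) =
      pad ((supNorm (minNormPoint Q) ^ 2 / 16 /
          (‖minNormPoint Q‖ ^ 2 + supNorm (minNormPoint Q) ^ 2 / 16)) • minNormPoint Q)
        (‖minNormPoint Q‖ ^ 2 / (‖minNormPoint Q‖ ^ 2 + supNorm (minNormPoint Q) ^ 2 / 16) *
          (supNorm (minNormPoint Q) / 4)) 0 := by
  obtain ⟨hX, hX1, hm, hmX, hM, hXM⟩ := hQ.bounds
  have hx := pad_mem_convexHull_extend (minNormPoint_spec Q).1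
  have hin := minNormPoint_inner Q
  have hw : pad 0 (supNorm (minNormPoint Q) / 4) 0 ∈
      convexHull ℝ (Set.range (extend Q)) := by
    have hr := subset_convexHull ℝ (Set.range (extend Q)) ⟨newIdx N 2, rfl⟩
    have hs := subset_convexHull ℝ (Set.range (extend Q)) ⟨newIdx N 3, rfl⟩
    have := convex_convexHull ℝ (Set.range (extend Q)) hr hs
      (a := (maxOneNorm Q + 3) / (2 * maxOneNorm Q + 5))
      (b := (maxOneNorm Q + 2) / (2 * maxOneNorm Q + 5)) (by positivity) (by positivity)
      (by field_simp; ring)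
    rw [extend_new_two, extend_new_three, smul_pad, smul_pad, pad_add_pad] at this
    convert this using 2
    · simp
    · field_simp; ring
    · field_simp; ring
  set x := minNormPoint Q
  set X := ‖x‖ ^ 2 with hXdef
  set m := supNorm x
  have hpos : 0 < X + m ^ 2 / 16 := by positivity
  set τ := m ^ 2 / 16 / (X + m ^ 2 / 16) with hτ
  have hτ0 : 0 ≤ τ := by positivity
  have hτ' : X / (X + m ^ 2 / 16) = 1 - τ := by rw [hτ]; field_simp; ring
  rw [hτ']
  have hτX : τ * X = (1 - τ) * (m ^ 2 / 16) := by rw [← hτ', hτ]; field_simp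
  have hτ1 : 0 ≤ 1 - τ := by rw [← hτ']; positivity
  symm
  refine eq_minNormPoint ?_ fun j => ?_
  · have := convex_convexHull ℝ (Set.range (extend Q)) hx hw hτ0 hτ1 (by ring)
    rw [smul_pad, smul_pad, pad_add_pad] at this
    convert this using 2 <;> simp
  · have hn : ‖pad (τ • x) ((1 - τ) * (m / 4)) 0‖ ^ 2 = τ * X := by
      rw [norm_sq_pad, norm_smul, mul_pow, Real.norm_eq_abs, sq_abs, ← hXdef]
      linear_combination -(1 - τ) * hτX
    rw [hn]
    have hxx : inner ℝ x x = X := real_inner_self_eq_norm_sq x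
    rcases idx_cases j with ⟨i, rfl⟩ | rfl | rfl | rfl | rfl
    · rw [extend_old, inner_pad, inner_smul_left]
      have := mul_le_mul_of_nonneg_left (hin i) hτ0
      simpa using this
    · rw [extend_new_zero, inner_pad, inner_smul_left, inner_smul_right, hxx]
      simp only [conj_trivial]
      have := mul_nonneg hτ0 hX.le
      linarith
    · rw [extend_new_one, inner_pad, inner_smul_left, inner_smul_right, hxx]
      simp only [conj_trivial]
      have := mul_nonneg hτ0 hX.le
      linarith
    · rw [extend_new_two, inner_pad, inner_zero_right]
      linarith
    · rw [extend_new_three, inner_pad, inner_zero_right]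
      linarith

/-- The new minimum norm point has a positive coordinate m/4 · (…), and its norm is at most that of
(x*, 0, 0), which lies in the new hull. -/
theorem Good.extend (hQ : Good Q) : Good (extend Q) := by
  obtain ⟨hX, hX1, hm, hmX, hM, hXM⟩ := hQ.bounds
  constructor
  · intro h
    rw [minNormPoint_extend hQ] at h
    have := congrArg
      (fun v : EuclideanSpace ℝ (Fin (D + 1 + 2)) => v (Fin.natAdd (D + 1) 0)) h
    simp only [pad_natAdd_zero, PiLp.zero_apply] at this
    have h' : 0 < ‖minNormPoint Q‖ ^ 2 / (‖minNormPoint Q‖ ^ 2 +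
      supNorm (minNormPoint Q) ^ 2 / 16) * (supNorm (minNormPoint Q) / 4) := by positivity
    exact h'.ne' this
  · refine ((minNormPoint_spec (Wolfe.extend Q)).2 _
      (pad_mem_convexHull_extend (minNormPoint_spec Q).1)).trans ?_
    refine (pow_le_one_iff_of_nonneg (norm_nonneg _) two_ne_zero).1 ?_
    rw [norm_sq_pad]
    linarith

end MinNormExtend

/-! ### Rationality of the points -/

section Rational

variable {N D : ℕ} {Q : Fin (N + 1) → EuclideanSpace ℝ (Fin (D + 1))}

/-- The rational numbers among the real numbers. -/
noncomputable abbrev rationals : Subfield ℝ := (Rat.castHom ℝ).fieldRange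

theorem abs_mem_rationals {a : ℝ} (ha : a ∈ rationals) : |a| ∈ rationals := by
  rcases abs_choice a with h | h <;> rw [h]
  · exact ha
  · exact neg_mem ha

theorem pad_mem_rationals {d : ℕ} {v : EuclideanSpace ℝ (Fin d)} {a b : ℝ}
    (hv : ∀ c, v c ∈ rationals) (ha : a ∈ rationals) (hb : b ∈ rationals) (c : Fin (d + 2)) :
    pad v a b c ∈ rationals := by
  refine Fin.addCases (fun c => ?_) (fun c => ?_) c
  · rw [pad_castAdd]; exact hv c
  · fin_cases c
    · exact (pad_natAdd_zero v a b).symm ▸ ha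
    · exact (pad_natAdd_one v a b).symm ▸ hb

theorem supNorm_mem_rationals {v : EuclideanSpace ℝ (Fin (D + 1))}
    (hv : ∀ c, v c ∈ rationals) : supNorm v ∈ rationals := by
  obtain ⟨c, hc⟩ := exists_supNorm_eq v
  rw [hc]
  exact abs_mem_rationals (hv c)

theorem maxOneNorm_mem_rationals (hQ : ∀ i c, Q i c ∈ rationals) :
    maxOneNorm Q ∈ rationals := by
  obtain ⟨i, -, hi⟩ := Finset.exists_mem_eq_sup' Finset.univ_nonempty fun i => ∑ c, |Q i c|
  rw [maxOneNorm, hi]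
  exact sum_mem fun c _ => abs_mem_rationals (hQ i c)

theorem norm_sq_mem_rationals {v : EuclideanSpace ℝ (Fin (D + 1))}
    (hv : ∀ c, v c ∈ rationals) : ‖v‖ ^ 2 ∈ rationals := by
  rw [EuclideanSpace.real_norm_sq_eq]
  exact sum_mem fun c _ => pow_mem (hv c) 2

theorem smul_mem_rationals {d : ℕ} {v : EuclideanSpace ℝ (Fin d)} {t : ℝ} (ht : t ∈ rationals)
    (hv : ∀ c, v c ∈ rationals) (c : Fin d) : (t • v) c ∈ rationals := by
  rw [PiLp.smul_apply]
  exact mul_mem ht (hv c)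

theorem extend_mem_rationals (hQ : ∀ i c, Q i c ∈ rationals)
    (hx : ∀ c, minNormPoint Q c ∈ rationals) (j : Fin (N + 1 + 4)) (c : Fin (D + 1 + 2)) :
    extend Q j c ∈ rationals := by
  have hM := maxOneNorm_mem_rationals hQ
  have hm : supNorm (minNormPoint Q) / 4 ∈ rationals :=
    div_mem (supNorm_mem_rationals hx) (ofNat_mem rationals 4)
  have hhalf : (1 / 2 : ℝ) ∈ rationals := div_mem (one_mem _) (ofNat_mem rationals 2)
  rcases idx_cases j with ⟨i, rfl⟩ | rfl | rfl | rfl | rfl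
  · rw [extend_old]
    exact pad_mem_rationals (hQ i) (zero_mem _) (zero_mem _) c
  · rw [extend_new_zero]
    exact pad_mem_rationals (smul_mem_rationals hhalf hx) hm hM c
  · rw [extend_new_one]
    exact pad_mem_rationals (smul_mem_rationals hhalf hx) hm
      (neg_mem (add_mem hM (one_mem _))) c
  · rw [extend_new_two]
    exact pad_mem_rationals (fun _ => zero_mem _) hm
      (add_mem hM (ofNat_mem rationals 2)) c
  · rw [extend_new_three]
    exact pad_mem_rationals (fun _ => zero_mem _) hm
      (neg_mem (add_mem hM (ofNat_mem rationals 3))) c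

theorem minNormPoint_extend_mem_rationals (hQ : Good Q)
    (hx : ∀ c, minNormPoint Q c ∈ rationals) (c : Fin (D + 1 + 2)) :
    minNormPoint (extend Q) c ∈ rationals := by
  rw [minNormPoint_extend hQ]
  have hm := supNorm_mem_rationals hx
  have hX := norm_sq_mem_rationals hx
  have hm' : supNorm (minNormPoint Q) ^ 2 / 16 ∈ rationals :=
    div_mem (pow_mem hm 2) (ofNat_mem rationals 16)
  exact pad_mem_rationals (smul_mem_rationals (div_mem hm' (add_mem hX hm')) hx)
    (mul_mem (div_mem hX (add_mem hX hm')) (div_mem hm (ofNat_mem rationals 4))) (zero_mem _) c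

end Rational

/-! ### Combinatorics of the corral sequence -/

section Sequence

variable {N : ℕ}

theorem length_nextSequence (L : List (Finset (Fin (N + 1)))) :
    (nextSequence L).length = 2 * L.length + 4 := by
  simp [nextSequence]
  ring

/-- An empty member of `L` would make {r, s} occur twice in the next sequence; hence this
accompanies distinctness in the induction. -/
theorem empty_notMem_nextSequence {L : List (Finset (Fin (N + 1)))} (h : ∅ ∉ L) :
    ∅ ∉ nextSequence L := by
  have h1 : ∀ S : Finset (Fin (N + 1 + 4)), S.Nonempty → ∅ ≠ S := fun S hS => hS.ne_empty.symm
  intro hmem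
  simp only [nextSequence, List.mem_append, List.mem_map, List.mem_cons, List.not_mem_nil,
    or_false] at hmem
  rcases hmem with (⟨S, hS, hS0⟩ | h0 | h0 | h0 | h0) | ⟨S, hS, h0⟩
  · rw [Finset.map_eq_empty] at hS0
    exact h (hS0 ▸ hS)
  · exact h1 _ (by simp) h0
  · exact h1 _ (by simp) h0
  · exact h1 _ (by simp) h0
  · exact h1 _ (by simp) h0
  · exact h1 _ (by simp) h0.symm

theorem nodup_nextSequence {L : List (Finset (Fin (N + 1)))} (h0 : ∅ ∉ L) (h : L.Nodup) :
    (nextSequence L).Nodup := by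
  have hold : ∀ (S : Finset (Fin (N + 1))) (a : Fin 4) (T : Finset (Fin (N + 1 + 4))),
      newIdx N a ∈ T → S.map (oldEmb N) ≠ T := by
    rintro S a T hT rfl
    exact newIdx_notMem_map S a hT
  have hmem : ∀ (T T' : Finset (Fin (N + 1 + 4))) (j : Fin (N + 1 + 4)),
      j ∈ T → j ∉ T' → T ≠ T' := by
    rintro T _ j hT hT' rfl
    exact hT' hT
  have hlast : ∀ S ∈ L, ∀ T : Finset (Fin (N + 1 + 4)), (∀ i, oldEmb N i ∉ T) →
      T ≠ S.map (oldEmb N) ∪ {newIdx N 2, newIdx N 3} := by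
    rintro S hS T hT rfl
    rcases S.eq_empty_or_nonempty with rfl | ⟨i, hi⟩
    · exact h0 hS
    · exact hT i (Finset.mem_union_left _ (Finset.mem_map_of_mem _ hi))
  unfold nextSequence
  refine List.Nodup.append (List.Nodup.append ?_ ?_ ?_) ?_ ?_
  · exact h.map (Finset.map_injective _)
  · simp only [List.nodup_cons, List.mem_cons, List.not_mem_nil, or_false, not_or,
      not_false_eq_true, List.nodup_nil, and_true]
    refine ⟨⟨(hmem _ _ (newIdx N 1) ?_ ?_).symm, (hmem _ _ (newIdx N 1) ?_ ?_).symm,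
      hmem _ _ (newIdx N 0) ?_ ?_⟩, ⟨hmem _ _ (newIdx N 0) ?_ ?_, hmem _ _ (newIdx N 0) ?_ ?_⟩,
      hmem _ _ (newIdx N 1) ?_ ?_⟩ <;>
    simp [newIdx_eq_iff, newIdx_notMem_map, -Finset.mem_map]
  · intro T hT hT'
    obtain ⟨S, hS, rfl⟩ := List.mem_map.1 hT
    simp only [List.mem_cons, List.not_mem_nil, or_false] at hT'
    rcases hT' with h' | h' | h' | h'
    · exact hold S 0 _ (by simp) h'
    · exact hold S 0 _ (by simp) h'
    · exact hold S 1 _ (by simp) h'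
    · exact hold S 2 _ (by simp) h'
  · refine List.Nodup.map_on (fun S _ S' _ e => ?_) h
    ext i
    have := congrArg (fun T => oldEmb N i ∈ T) e
    simpa [oldEmb_ne_newIdx] using this
  · intro T hT hT'
    obtain ⟨S, hS, rfl⟩ := List.mem_map.1 hT'
    rcases List.mem_append.1 hT with hT | hT
    · obtain ⟨S', -, e⟩ := List.mem_map.1 hT
      exact hold S' 2 _ (by simp) e
    · simp only [List.mem_cons, List.not_mem_nil, or_false] at hT
      rcases hT with h' | h' | h' | h'
      · exact hmem _ _ (newIdx N 2) (by simp)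
          (by simp [newIdx_eq_iff, newIdx_notMem_map, -Finset.mem_map]) h'
      all_goals exact hlast S hS _ (by simp [oldEmb_ne_newIdx]) h'.symm

/-- The corral sequence on `P n`. -/
def corralSequence : (n : ℕ) → List (Finset (Fin (4 * n + 1)))
  | 0 => [{0}]
  | n + 1 => nextSequence (N := 4 * n) (corralSequence n)

theorem corralSequence_nodup (n : ℕ) :
    ∅ ∉ corralSequence n ∧ (corralSequence n).Nodup := by
  induction n with
  | zero => simp [corralSequence]
  | succ n ih => exact ⟨empty_notMem_nextSequence ih.1, nodup_nextSequence ih.1 ih.2⟩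

/-- The recursion a ↦ 2a + 4 has fixed point -4, so a + 4 doubles; this form also avoids truncated
subtraction. -/
theorem corralSequence_length (n : ℕ) : (corralSequence n).length + 4 = 5 * 2 ^ n := by
  induction n with
  | zero => rfl
  | succ n ih =>
    have : (corralSequence (n + 1)).length = 2 * (corralSequence n).length + 4 :=
      length_nextSequence (N := 4 * n) _
    rw [this, pow_succ]
    omega

theorem corralSequence_ne_nil (n : ℕ) : corralSequence n ≠ [] := by
  intro h
  have h1 := corralSequence_length n
  have h2 : 1 ≤ 2 ^ n := Nat.one_le_two_pow
  rw [h, List.length_nil] at h1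
  omega

end Sequence

/-! ### The induction over the dimension -/

section Main

theorem minNormPoint_P_zero : minNormPoint (P 0) = WithLp.toLp 2 fun _ => 1 := by
  have h := (minNormPoint_spec (P 0)).1
  have hr : Set.range (P 0) = {WithLp.toLp 2 fun _ => 1} := Set.range_const
  rwa [hr, convexHull_singleton, Set.mem_singleton_iff] at h

theorem good_P (n : ℕ) : Good (N := 4 * n) (D := 2 * n) (P n) := by
  induction n with
  | zero =>
    constructor
    · intro h
      rw [minNormPoint_P_zero] at h
      have := congrArg (fun v => v 0) h
      simp at this
    · rw [minNormPoint_P_zero, EuclideanSpace.norm_eq]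
      simp
  | succ n ih => exact ih.extend

theorem P_mem_rationals (n : ℕ) : (∀ i c, P n i c ∈ rationals) ∧
    ∀ c, minNormPoint (P n) c ∈ rationals := by
  induction n with
  | zero =>
    refine ⟨fun i c => one_mem _, fun c => ?_⟩
    rw [minNormPoint_P_zero]
    exact one_mem _
  | succ n ih =>
    exact ⟨extend_mem_rationals (N := 4 * n) (D := 2 * n) ih.1 ih.2,
      minNormPoint_extend_mem_rationals (good_P n) ih.2⟩

theorem forced_P (n : ℕ) : ∀ i, (∀ j, ‖P n i‖ ≤ ‖P n j‖) →
    Forced (P n) ⟨{i}, Pi.single i 1⟩ (corralSequence n) := by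
  induction n with
  | zero =>
    intro i _
    obtain rfl : i = 0 := Subsingleton.elim (α := Fin 1) i 0
    refine Forced.halt _ (Or.inr fun j => ?_)
    obtain rfl : j = 0 := Subsingleton.elim (α := Fin 1) j 0
    exact (settled_singleton (P 0) 0).not_improving (Finset.mem_singleton_self 0)
  | succ n ih => exact forced_extend (N := 4 * n) (D := 2 * n) (good_P n) ih

theorem isCorralSequence_P_iff (n : ℕ) (L : List (Finset (Fin (4 * n + 1)))) :
    IsCorralSequence (P n) L ↔ L = corralSequence n := by
  constructor
  · rintro ⟨i, hi, hL⟩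
    exact ((forced_P n i hi).runFrom_iff (settled_singleton _ i) L).1 hL
  · intro hL
    obtain ⟨i, hi⟩ := Finite.exists_min fun i => ‖P n i‖
    exact ⟨i, hi, ((forced_P n i hi).runFrom_iff (settled_singleton _ i) L).2 hL⟩

theorem isCorral_of_mem_corralSequence (n : ℕ) : ∀ S ∈ corralSequence n, IsCorral (P n) S := by
  obtain ⟨i, hi⟩ := Finite.exists_min fun i => ‖P n i‖
  exact (forced_P n i hi).isCorral (settled_singleton _ i)

end Main

end Wolfe

theorem mainTheorem1 :
    -- the points are rational
    (∀ (n : ℕ) (i : Fin (4 * n + 1)) (c : Fin (2 * n + 1)), ∃ a : ℚ, Wolfe.P n i c = (a : ℝ)) ∧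
    ∃ C : (n : ℕ) → List (Finset (Fin (4 * n + 1))),
      -- on `P_d`, `d = 2 * n + 1`, the method has exactly one corral sequence, namely `C n`
      (∀ (n : ℕ) (L : List (Finset (Fin (4 * n + 1)))),
        Wolfe.IsCorralSequence (Wolfe.P n) L ↔ L = C n) ∧
      -- its members are corrals and pairwise distinct
      (∀ (n : ℕ), ∀ S ∈ C n, Wolfe.IsCorral (Wolfe.P n) S) ∧
      (∀ n : ℕ, (C n).Nodup) ∧
      -- its length
      (∀ k : ℕ, 1 ≤ k → (C (k - 1)).length = 5 * 2 ^ (k - 1) - 4) ∧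
      -- its recursive structure, `O` being the last corral on `P_(d-2)`
      (∀ n : ℕ, ∃ O : Finset (Fin (4 * n + 1)), (C n).getLast? = some O ∧
        C (n + 1) =
          (C n).map (fun S => S.map (Wolfe.old n)) ++
          [O.map (Wolfe.old n) ∪ {Wolfe.new n 0},
            {Wolfe.new n 0, Wolfe.new n 1},
            {Wolfe.new n 1, Wolfe.new n 2},
            {Wolfe.new n 2, Wolfe.new n 3}] ++
          (C n).map (fun S => S.map (Wolfe.old n) ∪ {Wolfe.new n 2, Wolfe.new n 3})) := by
  refine ⟨fun n i c => ?_, Wolfe.corralSequence, Wolfe.isCorralSequence_P_iff,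
    Wolfe.isCorral_of_mem_corralSequence, fun n => (Wolfe.corralSequence_nodup n).2,
    fun k _ => ?_, fun n => ?_⟩
  · obtain ⟨a, ha⟩ := (Wolfe.P_mem_rationals n).1 i c
    exact ⟨a, ha.symm⟩
  · have := Wolfe.corralSequence_length (k - 1)
    omega
  · have hO := List.getLast?_eq_some_getLast (Wolfe.corralSequence_ne_nil n)
    refine ⟨_, hO, ?_⟩
    change Wolfe.nextSequence (N := 4 * n) (Wolfe.corralSequence n) = _
    rw [Wolfe.nextSequence, hO]
    rfl
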